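/- **Lemma 3.3.** Write $\zeta=(\xi,\eta)$, $\langle a\rangle=\sqrt{1+|a|^2}$ and $\mathcal F(u)(\xi,\eta,\tau)=\iiint u(x,y,t)\,e^{-i(x\xi+y\eta+t\tau)}\,dx\,dy\,dt$, extended to tempered distributions. For $s,b\in\mathbb R$ let $X_{s,b}$ be the space of all (complex-valued) tempered distributions $u$ on $\mathbb R^2\times\mathbb R$ such that $\mathcal F(u)$ is a locally integrable function and $$\|u\|_{X_{s,b}}=\big\|\langle\zeta\rangle^s\,\langle\tau-(\xi^3+\eta^3)\rangle^b\,\mathcal F(u)(\xi,\eta,\tau)\big\|_{L^2_{\xi,\eta,\tau}}<\infty .$$ Let $\tfrac34<s<1$ and $0<\varepsilon\le\tfrac14$. Then there is a constant $C=C(s,\varepsilon)$ such that for all $u_1,u_2,u_3\in X_{s,\frac12+\varepsilon}$ the following holds: the $u_i$ are locally integrable functions, their pointwise product $u_1u_2u_3$ is a locally integrable function that defines a tempered distribution, and $$\big\|(\partial_x+\partial_y)(u_1u_2u_3)\big\|_{X_{s,-\frac12+2\varepsilon}}\le C\prod_{i=1}^3\|u_i\|_{X_{s,\frac12+\varepsilon}}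 .$$ -/

import Mathlib

open MeasureTheory FourierTransform
open scoped SchwartzMap LineDeriv NNReal ENNReal

noncomputable section

namespace MZK

/-- The space-time `ℝ² × ℝ`, with coordinates `p 0 = x`, `p 1 = y`, `p 2 = t` in physical space and
`p 0 = ξ`, `p 1 = η`, `p 2 = τ` in frequency space, with Lebesgue measure. -/
abbrev SpaceTime : Type := EuclideanSpace ℝ (Fin 3)

/-- The Fourier transform `ω ↦ ∫ φ(p) e^{-i p·ω} dp` on the Schwartz class, obtained from Mathlib's
transform `ω ↦ ∫ φ(p) e^{-2πi p·ω} dp` by the dilation `ω ↦ (2π)⁻¹ ω`. -/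
def fourierSchwartz : 𝓢(SpaceTime, ℂ) →L[ℂ] 𝓢(SpaceTime, ℂ) :=
  (SchwartzMap.compCLMOfContinuousLinearEquiv ℂ
    (ContinuousLinearEquiv.smulLeft (Units.mk0 ((2 * Real.pi)⁻¹ : ℝ)
      (inv_ne_zero Real.two_pi_pos.ne')) : SpaceTime ≃L[ℝ] SpaceTime)) ∘L
  fourierCLM ℂ 𝓢(SpaceTime, ℂ)

theorem fourierSchwartz_apply (φ : 𝓢(SpaceTime, ℂ)) (ω : SpaceTime) :
    fourierSchwartz φ ω = ∫ p : SpaceTime,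
      Complex.exp (-Complex.I * ((p 0 * ω 0 + p 1 * ω 1 + p 2 * ω 2 : ℝ) : ℂ)) * φ p := by
  have h : fourierSchwartz φ ω = 𝓕 (φ : SpaceTime → ℂ) ((2 * Real.pi)⁻¹ • ω) := rfl
  rw [h, Real.fourier_eq']
  refine integral_congr_ae (Filter.Eventually.of_forall fun p => ?_)
  have h2 : (-2 * Real.pi * inner ℝ p ((2 * Real.pi)⁻¹ • ω) : ℝ)
      = -(p 0 * ω 0 + p 1 * ω 1 + p 2 * ω 2) := by
    rw [inner_smul_right, PiLp.inner_apply, Fin.sum_univ_three]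
    simp only [RCLike.inner_apply, conj_trivial]
    field_simp
  simp only [h2, smul_eq_mul]
  congr 2
  push_cast
  ring

/-- The Fourier transform of a tempered distribution, by duality: `⟨𝓕u, φ⟩ = ⟨u, 𝓕φ⟩`. -/
def fourierDist (u : 𝓢'(SpaceTime, ℂ)) : 𝓢'(SpaceTime, ℂ) :=
  PointwiseConvergenceCLM.precomp ℂ fourierSchwartz u

/-- The tempered distribution `T` is (given by integration against) the locally integrable
function `f`. Such an `f` is unique up to equality almost everywhere. -/
def IsFunction (T : 𝓢'(SpaceTime, ℂ)) (f : SpaceTime → ℂ) : Prop :=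
  LocallyIntegrable f volume ∧
    ∀ φ : 𝓢(SpaceTime, ℂ),
      Integrable (fun p => φ p * f p) volume ∧ T φ = ∫ p, φ p * f p

theorem IsFunction.ae_eq {T : 𝓢'(SpaceTime, ℂ)} {f g : SpaceTime → ℂ} (hf : IsFunction T f)
    (hg : IsFunction T g) : f =ᵐ[volume] g := by
  refine ae_eq_of_integral_contDiff_smul_eq hf.1 hg.1 fun φ hφ hc => ?_
  have hc' : HasCompactSupport (fun p => (φ p : ℂ)) := hc.comp_left Complex.ofReal_zero
  have hφ' : ContDiff ℝ _ (fun p => (φ p : ℂ)) := Complex.ofRealCLM.contDiff.comp hφ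
  have h := (hf.2 (hc'.toSchwartzMap hφ')).2.symm.trans (hg.2 (hc'.toSchwartzMap hφ')).2
  simpa using h

/-- The weight `⟨ζ⟩^s ⟨τ - (ξ³ + η³)⟩^b`, where `ζ = (ξ, η)` and `⟨a⟩ = √(1 + |a|²)`. -/
def weight (s b : ℝ) (ω : SpaceTime) : ℝ :=
  Real.sqrt (1 + (ω 0 ^ 2 + ω 1 ^ 2)) ^ s *
    Real.sqrt (1 + (ω 2 - (ω 0 ^ 3 + ω 1 ^ 3)) ^ 2) ^ b

/-- The norm `‖⟨ζ⟩^s ⟨τ - (ξ³ + η³)⟩^b 𝓕u‖_{L²}`, with the value `∞` if `𝓕u` is not a function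
(the infimum runs over the representatives of `𝓕u`, which are equal almost everywhere). -/
def xNorm (s b : ℝ) (u : 𝓢'(SpaceTime, ℂ)) : ℝ≥0∞ :=
  ⨅ (g : SpaceTime → ℂ) (_ : IsFunction (fourierDist u) g),
    eLpNorm (fun ω => (weight s b ω : ℂ) * g ω) 2 volume

theorem xNorm_eq {s b : ℝ} {u : 𝓢'(SpaceTime, ℂ)} {g : SpaceTime → ℂ}
    (hg : IsFunction (fourierDist u) g) :
    xNorm s b u = eLpNorm (fun ω => (weight s b ω : ℂ) * g ω) 2 volume := by
  refine le_antisymm (iInf₂_le g hg) (le_iInf₂ fun g' hg' => le_of_eq (eLpNorm_congr_ae ?_))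
  filter_upwards [hg.ae_eq hg'] with ω h
  rw [h]

/-- The Bourgain space `X_{s,b}`. -/
def XSpace (s b : ℝ) : Set 𝓢'(SpaceTime, ℂ) := {u | xNorm s b u < ∞}

/-- `w` is the product `u₁ u₂ u₃`: the `uᵢ` are functions and `w` is their pointwise product. -/
def IsProduct (u₁ u₂ u₃ w : 𝓢'(SpaceTime, ℂ)) : Prop :=
  ∃ f₁ f₂ f₃ : SpaceTime → ℂ, IsFunction u₁ f₁ ∧ IsFunction u₂ f₂ ∧ IsFunction u₃ f₃ ∧
    IsFunction w (fun p => f₁ p * f₂ p * f₃ p)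

/-- The distributional derivative `(∂ₓ + ∂_y) w`. -/
def dxdy (w : 𝓢'(SpaceTime, ℂ)) : 𝓢'(SpaceTime, ℂ) :=
  ∂_{(EuclideanSpace.single 0 1 : SpaceTime)} w + ∂_{(EuclideanSpace.single 1 1 : SpaceTime)} w

end MZK

end

noncomputable section

namespace MZK

open Set Filter Topology

/-! The estimate is a weighted convolution bound on the Fourier side. Write `2s = 3/2 + 2θ` with `θ
= s - 3/4 ∈ (0, 1/4)`. Since `ε ≤ 1/4`, the modulation exponent `-1/2 + 2ε` on the left is
nonpositive, so that weight is at most 1 and is dropped. Since `|ξ + η| ≤ 2⟨ζ⟩`, the derivative and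
the spatial weight together cost at most `2⟨ζ⟩^(1+s)`.

Cauchy–Schwarz on the set of frequencies with a fixed sum reduces the bound to a kernel estimate
uniform in `(ζ, τ)`: the integral of `⟨ζ⟩^(2+2s) ∏ ⟨ζᵢ⟩^(-2s) ⟨τᵢ - φ(ζᵢ)⟩^(-2b)`, with `φ = ξ³ +
η³` and `b = 1/2 + ε`, must stay bounded. As `2b > 1`, integrating in the times leaves `⟨τ - φ(ζ₁) -
φ(ζ₂) - φ(ζ₃)⟩^(-2b)`. By symmetry, `⟨ζ₁⟩ ≥ ⟨ζ₂⟩ ≥ ⟨ζ₃⟩` may be assumed.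

If `4⟨ζ₂⟩ ≤ ⟨ζ₁⟩`, then `⟨ζ₁⟩²` is controlled by `|ξ₁² - ξ₂²|` or by `|η₁² - η₂²|`. Up to a factor 3
this is the derivative of the phase in one coordinate of `ζ₂` at fixed `ζ₁ + ζ₂`, and it pays for
the growth; the remaining weights are integrable (`exists_lintegral_smoothing_fst_le` and its mirror
image).

If `⟨ζ₁⟩` and `⟨ζ₂⟩` are comparable, the phase is a diagonal quadratic form in `ζ₁ - ζ₂`, whose
coefficients are multiples of the coordinates of `ζ - ζ₃`. A leftover `⟨ζ₁⟩^(-θ)` removes the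
logarithmic divergence possible for an indefinite form, and the integral in `ζ₂` leaves a product of
integrable singularities in `ζ - ζ₃` (`exists_lintegral_comparable_le`,
`exists_lintegral_far_frequency_le`).

The product itself is identified in `fourierInv_cconv_ae_eq`: the kernel estimate puts the
convolution of absolute values in `L²`, so truncating the transforms to balls and passing to the
limit identifies the pointwise product with the inverse transform of the convolution. -/

/-- The Japanese bracket `√(1 + x²)` on the line. -/
def jb (x : ℝ) : ℝ := Real.sqrt (1 + x ^ 2)

/-! ### Elementary inequalities for the bracket on the line. -/

lemma one_le_jb (x : ℝ) : 1 ≤ jb x := by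
  unfold jb; rw [Real.one_le_sqrt]; nlinarith [sq_nonneg x]

lemma jb_pos (x : ℝ) : 0 < jb x := lt_of_lt_of_le one_pos (one_le_jb x)

lemma jb_neg (x : ℝ) : jb (-x) = jb x := by simp [jb]

lemma jb_sub_comm (x y : ℝ) : jb (x - y) = jb (y - x) := by rw [← jb_neg, neg_sub]

lemma abs_le_jb (x : ℝ) : |x| ≤ jb x := by
  unfold jb; apply Real.le_sqrt_of_sq_le; rw [sq_abs]; linarith

lemma jb_add_le (x y : ℝ) : jb (x + y) ≤ |x| + jb y := by
  have h1 : jb y ^ 2 = 1 + y ^ 2 := Real.sq_sqrt (by positivity)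
  have h2 := abs_le_jb y
  have h3 : 0 ≤ |x| := abs_nonneg x
  apply Real.sqrt_le_iff.2 ⟨by positivity [jb_pos y], ?_⟩
  have h4 : x * y ≤ |x| * jb y := by
    calc x * y ≤ |x * y| := le_abs_self _
      _ = |x| * |y| := abs_mul x y
      _ ≤ _ := by gcongr
  nlinarith [sq_abs x]

lemma jb_le_sqrt_two_mul (x : ℝ) (hx : 1 ≤ |x|) : jb x ≤ 2 * |x| := by
  apply Real.sqrt_le_iff.2 ⟨by positivity, ?_⟩
  nlinarith [sq_abs x]

lemma continuous_jb : Continuous jb := by unfold jb; fun_prop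

@[fun_prop]
lemma measurable_jb : Measurable jb := continuous_jb.measurable

lemma jb_rpow_nonneg (x p : ℝ) : 0 ≤ jb x ^ p := Real.rpow_nonneg (jb_pos x).le _

lemma jb_rpow_neg_le_one (x : ℝ) {p : ℝ} (hp : 0 ≤ p) : jb x ^ (-p) ≤ 1 :=
  Real.rpow_le_one_of_one_le_of_nonpos (one_le_jb x) (by linarith)

lemma rpow_add_le_of_le_one {x y p : ℝ} (hx : 0 ≤ x) (hy : 0 ≤ y) (hp : 0 ≤ p) (hp1 : p ≤ 1) :
    (x + y) ^ p ≤ x ^ p + y ^ p := by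
  have := NNReal.rpow_add_le_add_rpow ⟨x, hx⟩ ⟨y, hy⟩ hp hp1
  exact_mod_cast this

/-! ### Integrals on the line of brackets and power singularities, uniform in translations. -/

/-- An even function has twice the integral it has over the positive half-line. -/
lemma lintegral_even {f : ℝ → ℝ≥0∞} (hf : ∀ x, f (-x) = f x) :
    ∫⁻ x, f x = 2 * ∫⁻ x in Ioi 0, f x := by
  have h1 : ∫⁻ x in Iio 0, f x = ∫⁻ x in Ioi 0, f x := by
    have h := (Measure.measurePreserving_neg (volume : Measure ℝ)).setLIntegral_comp_preimage_emb
      (MeasurableEquiv.neg ℝ).measurableEmbedding f (Ioi 0)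
    rw [← h]
    simp [hf]
  rw [← lintegral_add_compl f (measurableSet_Ioi (a := (0 : ℝ))), compl_Ioi,
    setLIntegral_congr (Iio_ae_eq_Iic (a := (0 : ℝ)) (μ := volume)).symm, h1, two_mul]

lemma lintegral_jb_rpow_lt_top {q : ℝ} (hq : 1 < q) :
    ∫⁻ w, ENNReal.ofReal (jb w ^ (-q)) < ∞ := by
  have h := integrable_rpow_neg_one_add_norm_sq (E := ℝ) (μ := volume) (r := q) (by simpa using hq)
  have h2 : (fun w : ℝ => jb w ^ (-q)) = fun x : ℝ => ((1 : ℝ) + ‖x‖ ^ 2) ^ (-q / 2) := by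
    ext w
    rw [jb, Real.sqrt_eq_rpow, ← Real.rpow_mul (by positivity)]
    congr 1
    · simp
    · ring
  rw [← h2] at h
  exact h.lintegral_lt_top

lemma exists_lintegral_jb_le {q : ℝ} (hq : 1 < q) :
    ∃ C : ℝ≥0, ∀ r, ∫⁻ w, ENNReal.ofReal (jb (w - r) ^ (-q)) ≤ C := by
  refine ⟨(∫⁻ w, ENNReal.ofReal (jb w ^ (-q))).toNNReal, fun r => ?_⟩
  rw [ENNReal.coe_toNNReal (lintegral_jb_rpow_lt_top hq).ne,
    lintegral_sub_right_eq_self (fun w => ENNReal.ofReal (jb w ^ (-q)))]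

lemma lintegral_abs_rpow_unit_lt_top {p : ℝ} (hp1 : p < 1) :
    ∫⁻ w, ENNReal.ofReal ((Icc (-1 : ℝ) 1).indicator (fun x => |x| ^ (-p)) w) < ∞ := by
  rw [lintegral_even]
  · refine ENNReal.mul_lt_top (by simp) ?_
    have h := (intervalIntegral.intervalIntegrable_rpow' (a := 0) (b := 1) (r := -p)
      (by linarith)).1
    refine lt_of_le_of_lt ?_ h.lintegral_lt_top
    rw [← lintegral_indicator measurableSet_Ioi, ← lintegral_indicator measurableSet_Ioc]
    apply lintegral_mono
    intro x
    simp only [indicator, mem_Ioi, mem_Icc, mem_Ioc]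
    split_ifs with h1 h2 h3 <;> try simp
    · rw [abs_of_pos h1]
    · exact absurd ⟨h1, h2.2⟩ h3
  · intro x
    simp only [indicator, mem_Icc, abs_neg]
    congr 1
    refine if_congr ?_ rfl rfl
    constructor <;> rintro ⟨h1, h2⟩ <;> constructor <;> linarith

/-- The smaller base can carry the whole exponent. -/
lemma rpow_neg_mul_le_add {a b p q : ℝ} (ha : 0 < a) (hb : 0 < b) (hp : 0 ≤ p) (hq : 0 ≤ q) :
    a ^ (-p) * b ^ (-q) ≤ a ^ (-(p + q)) + b ^ (-(p + q)) := by
  have ha' := Real.rpow_nonneg ha.le (-(p + q))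
  have hb' := Real.rpow_nonneg hb.le (-(p + q))
  rcases le_total a b with h | h
  · have : b ^ (-q) ≤ a ^ (-q) := Real.rpow_le_rpow_of_nonpos ha h (by linarith)
    calc a ^ (-p) * b ^ (-q) ≤ a ^ (-p) * a ^ (-q) := by gcongr
      _ = a ^ (-(p + q)) := by rw [← Real.rpow_add ha]; ring_nf
      _ ≤ _ := by linarith
  · have : a ^ (-p) ≤ b ^ (-p) := Real.rpow_le_rpow_of_nonpos hb h (by linarith)
    calc a ^ (-p) * b ^ (-q) ≤ b ^ (-p) * b ^ (-q) := by gcongr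
      _ = b ^ (-(p + q)) := by rw [← Real.rpow_add hb]; ring_nf
      _ ≤ _ := by linarith

/-- Within distance 1 of `r` the bracket is dropped and `p < 1` suffices. Farther away `|w - r|` is
comparable to its bracket, and the product of two decays is at most a sum of brackets with
integrable exponent `p + q`; translation invariance makes the bound uniform. -/
lemma exists_lintegral_singular_le {p q : ℝ} (hp : 0 ≤ p) (hp1 : p < 1) (hq : 0 ≤ q)
    (hpq : 1 < p + q) :
    ∃ C : ℝ≥0, ∀ r, ∫⁻ w, ENNReal.ofReal (|w - r| ^ (-p) * jb w ^ (-q)) ≤ C := by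
  set g : ℝ → ℝ := (Icc (-1 : ℝ) 1).indicator (fun x => |x| ^ (-p)) with hg
  set I := ∫⁻ w, ENNReal.ofReal (g w)
  set J := ∫⁻ w, ENNReal.ofReal (jb w ^ (-(p + q)))
  have hI : I ≠ ∞ := (lintegral_abs_rpow_unit_lt_top hp1).ne
  have hJ : J ≠ ∞ := (lintegral_jb_rpow_lt_top hpq).ne
  have hfin : I + ENNReal.ofReal (2 ^ p) * (J + J) ≠ ∞ := by finiteness
  refine ⟨(I + ENNReal.ofReal (2 ^ p) * (J + J)).toNNReal, fun r => ?_⟩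
  rw [ENNReal.coe_toNNReal hfin]
  have hgm : Measurable g := Measurable.indicator (by fun_prop) measurableSet_Icc
  have hpt : ∀ w, ENNReal.ofReal (|w - r| ^ (-p) * jb w ^ (-q)) ≤ ENNReal.ofReal (g (w - r)) +
      ENNReal.ofReal (2 ^ p) * (ENNReal.ofReal (jb (w - r) ^ (-(p + q))) +
        ENNReal.ofReal (jb w ^ (-(p + q)))) := by
    intro w
    by_cases h : w - r ∈ Icc (-1 : ℝ) 1
    · refine le_add_right (ENNReal.ofReal_le_ofReal ?_)
      rw [hg, indicator_of_mem h]
      exact mul_le_of_le_one_right (by positivity) (jb_rpow_neg_le_one w hq)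
    · refine le_add_left ?_
      rw [← ENNReal.ofReal_add (jb_rpow_nonneg _ _) (jb_rpow_nonneg _ _),
        ← ENNReal.ofReal_mul (by positivity)]
      apply ENNReal.ofReal_le_ofReal
      have h1 : 1 ≤ |w - r| := by
        rw [mem_Icc, ← abs_le] at h
        linarith
      have h2 : |w - r| ^ (-p) ≤ 2 ^ p * jb (w - r) ^ (-p) := by
        have := Real.rpow_le_rpow_of_nonpos (jb_pos (w - r)) (jb_le_sqrt_two_mul _ h1)
          (z := -p) (by linarith)
        rw [Real.mul_rpow (by norm_num) (by positivity), Real.rpow_neg (by norm_num)] at this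
        rwa [← inv_mul_le_iff₀ (by positivity)]
      calc _ ≤ 2 ^ p * jb (w - r) ^ (-p) * jb w ^ (-q) := by
            gcongr; exact jb_rpow_nonneg _ _
        _ = 2 ^ p * (jb (w - r) ^ (-p) * jb w ^ (-q)) := by ring
        _ ≤ _ := by gcongr; exact rpow_neg_mul_le_add (jb_pos _) (jb_pos _) hp hq
  calc _ ≤ _ := lintegral_mono hpt
    _ = _ := by
      rw [lintegral_add_left (by fun_prop), lintegral_const_mul _ (by fun_prop),
        lintegral_add_left (by fun_prop), lintegral_sub_right_eq_self (fun w => ENNReal.ofReal (g w)),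
        lintegral_sub_right_eq_self (fun w => ENNReal.ofReal (jb w ^ (-(p + q))))]

lemma exists_lintegral_singular_le' {p q : ℝ} (hp : 0 ≤ p) (hp1 : p < 1) (hq : 0 ≤ q)
    (hpq : 1 < p + q) :
    ∃ C : ℝ≥0, ∀ r, ∫⁻ w, ENNReal.ofReal (|w| ^ (-p) * jb (w - r) ^ (-q)) ≤ C := by
  obtain ⟨C, hC⟩ := exists_lintegral_singular_le hp hp1 hq hpq
  refine ⟨C, fun r => ?_⟩
  have := lintegral_sub_right_eq_self (μ := volume)
    (fun w => ENNReal.ofReal (|w - (-r)| ^ (-p) * jb w ^ (-q))) r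
  simp only [sub_neg_eq_add, sub_add_cancel] at this
  rw [this]
  simpa using hC (-r)

lemma jb_rpow_le_add {x y p : ℝ} (hp : 0 ≤ p) (hp1 : p ≤ 1) :
    jb x ^ p ≤ |x - y| ^ p + jb y ^ p := by
  have h := jb_add_le (x - y) y
  rw [sub_add_cancel] at h
  exact (Real.rpow_le_rpow (jb_pos x).le h hp).trans
    (rpow_add_le_of_le_one (abs_nonneg _) (jb_pos y).le hp hp1)

/-- One of `x - y` and `y` has bracket at least `jb x / 2`; that factor gives the decay and the
other is integrated. -/
lemma exists_lintegral_jb_conv_le {q : ℝ} (hq : 1 < q) :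
    ∃ C : ℝ≥0, ∀ x, ∫⁻ y, ENNReal.ofReal (jb (x - y) ^ (-q) * jb y ^ (-q)) ≤
      C * ENNReal.ofReal (jb x ^ (-q)) := by
  set J := ∫⁻ w, ENNReal.ofReal (jb w ^ (-q))
  have hJ : J ≠ ∞ := (lintegral_jb_rpow_lt_top hq).ne
  have hfin : ENNReal.ofReal (2 ^ q) * (J + J) ≠ ∞ := by finiteness
  refine ⟨(ENNReal.ofReal (2 ^ q) * (J + J)).toNNReal, fun x => ?_⟩
  rw [ENNReal.coe_toNNReal hfin]
  have hpt : ∀ y, ENNReal.ofReal (jb (x - y) ^ (-q) * jb y ^ (-q)) ≤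
      (ENNReal.ofReal (2 ^ q) * (ENNReal.ofReal (jb (x - y) ^ (-q)) +
        ENNReal.ofReal (jb y ^ (-q)))) * ENNReal.ofReal (jb x ^ (-q)) := by
    intro y
    rw [← ENNReal.ofReal_add (jb_rpow_nonneg _ _) (jb_rpow_nonneg _ _),
      ← ENNReal.ofReal_mul (by positivity), ← ENNReal.ofReal_mul]
    swap; · have := jb_rpow_nonneg (x - y) (-q); have := jb_rpow_nonneg y (-q); positivity
    apply ENNReal.ofReal_le_ofReal
    set a := jb (x - y)
    set b := jb y
    have hapos : 0 < a := jb_pos _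
    have hbpos : 0 < b := jb_pos _
    have hx : jb x ≤ a + b := by
      have := jb_add_le (x - y) y
      rw [sub_add_cancel] at this
      linarith [abs_le_jb (x - y)]
    have key : ∀ u v : ℝ, 0 < u → 0 < v → u ≤ v → jb x ≤ u + v →
        u ^ (-q) * v ^ (-q) ≤ 2 ^ q * u ^ (-q) * jb x ^ (-q) := by
      intro u v hu hv huv hle
      have h1 : jb x ≤ 2 * v := by linarith
      have h2 : (2 * v) ^ (-q) ≤ jb x ^ (-q) :=
        Real.rpow_le_rpow_of_nonpos (jb_pos x) h1 (by linarith)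
      rw [Real.mul_rpow (by norm_num) hv.le, Real.rpow_neg (by norm_num),
        inv_mul_le_iff₀ (by positivity)] at h2
      calc _ ≤ u ^ (-q) * (2 ^ q * jb x ^ (-q)) := by gcongr
        _ = _ := by ring
    have hx0 := jb_rpow_nonneg x (-q)
    have ha0 : 0 ≤ a ^ (-q) := by positivity
    have hb0 : 0 ≤ b ^ (-q) := by positivity
    have h20 : (0 : ℝ) ≤ 2 ^ q := by positivity
    rcases le_total a b with h | h
    · refine (key a b hapos hbpos h hx).trans ?_
      gcongr; linarith
    · rw [mul_comm (a ^ (-q))]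
      refine (key b a hbpos hapos h (by linarith)).trans ?_
      gcongr; linarith
  refine (lintegral_mono hpt).trans (le_of_eq ?_)
  rw [lintegral_mul_const _ (by fun_prop), lintegral_const_mul _ (by fun_prop),
    lintegral_add_left (by fun_prop), lintegral_sub_left_eq_self
      (fun w => ENNReal.ofReal (jb w ^ (-q)))]

/-! ### Quadratic phases in one and two variables. -/

lemma setLIntegral_comp_mul_sq {A : ℝ} (hA : 0 < A) (g : ℝ → ℝ≥0∞) :
    ∫⁻ x in Ioi 0, ENNReal.ofReal (2 * A * x) * g (A * x ^ 2) = ∫⁻ w in Ioi 0, g w := by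
  have him : (fun x : ℝ => A * x ^ 2) '' Ioi 0 = Ioi 0 := by
    ext w
    simp only [mem_image, mem_Ioi]
    constructor
    · rintro ⟨x, hx, rfl⟩; positivity
    · intro hw
      refine ⟨Real.sqrt (w / A), by positivity, ?_⟩
      rw [Real.sq_sqrt (by positivity)]; field_simp
  have hinj : InjOn (fun x : ℝ => A * x ^ 2) (Ioi 0) := by
    intro x hx y hy h
    have : x ^ 2 = y ^ 2 := mul_left_cancel₀ hA.ne' h
    exact (sq_eq_sq₀ (le_of_lt hx) (le_of_lt hy)).1 this
  have h := lintegral_image_eq_lintegral_abs_deriv_mul (measurableSet_Ioi (a := (0 : ℝ)))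
    (f := fun x => A * x ^ 2) (f' := fun x => 2 * A * x)
    (fun x _ => by
      have e : 2 * A * x = A * (((2 : ℕ) : ℝ) * x ^ (2 - 1)) := by norm_num; ring
      rw [e]
      exact ((hasDerivAt_pow 2 x).const_mul A).hasDerivWithinAt) hinj g
  rw [him] at h
  rw [h]
  refine setLIntegral_congr_fun measurableSet_Ioi fun x hx => ?_
  have hx' : 0 < x := hx
  rw [abs_of_pos (by positivity)]

/-- The factor `|A * x|` is half the Jacobian of `w = A * x ^ 2`, so the bound does not depend on
`A`. -/
lemma exists_lintegral_mul_jb_quadratic_le {q : ℝ} (hq : 1 < q) :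
    ∃ C : ℝ≥0, ∀ A v : ℝ, ∫⁻ x, ENNReal.ofReal (|A * x| * jb (v - A * x ^ 2) ^ (-q)) ≤ C := by
  obtain ⟨C, hC⟩ := exists_lintegral_jb_le hq
  have hpos : ∀ A v : ℝ, 0 < A →
      ∫⁻ x, ENNReal.ofReal (|A * x| * jb (v - A * x ^ 2) ^ (-q)) ≤ C := by
    intro A v hA
    rw [lintegral_even (by intro x; simp)]
    calc _ = ∫⁻ x in Ioi 0, 2 * ENNReal.ofReal (|A * x| * jb (v - A * x ^ 2) ^ (-q)) := by
          rw [lintegral_const_mul _ (by fun_prop)]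
      _ = ∫⁻ x in Ioi 0, ENNReal.ofReal (2 * A * x) *
            (fun w => ENNReal.ofReal (jb (w - v) ^ (-q))) (A * x ^ 2) := by
          refine setLIntegral_congr_fun measurableSet_Ioi fun x hx => ?_
          have hx' : 0 < x := hx
          simp only
          rw [abs_of_pos (by positivity), ← ENNReal.ofReal_mul (by positivity),
            show (2 : ℝ≥0∞) = ENNReal.ofReal 2 by simp, ← ENNReal.ofReal_mul (by positivity),
            jb_sub_comm]
          ring_nf
      _ = _ := setLIntegral_comp_mul_sq hA (fun w => ENNReal.ofReal (jb (w - v) ^ (-q)))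
      _ ≤ _ := (setLIntegral_le_lintegral _ _).trans (hC v)
  refine ⟨C, fun A v => ?_⟩
  rcases lt_trichotomy A 0 with h | rfl | h
  · refine (le_of_eq ?_).trans (hpos (-A) (-v) (by linarith))
    refine lintegral_congr fun x => ?_
    rw [neg_mul, abs_neg, neg_mul, ← jb_neg (-v - _)]
    ring_nf
  · simp
  · exact hpos A v h

/-- The power `jb v ^ β` is split as `|w| ^ β + jb (w - v) ^ β` and absorbed by one of the two
factors, which keep a total exponent above 1. -/
lemma exists_lintegral_rpow_neg_half_jb_le {q β : ℝ} (hq : 1 < q) (hβ : 0 ≤ β) (hβ2 : β < 1 / 2) :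
    ∃ C : ℝ≥0, ∀ v : ℝ, ∫⁻ w, ENNReal.ofReal (|w| ^ (-(1 / 2) : ℝ) * jb (w - v) ^ (-q)) ≤
      C * ENNReal.ofReal (jb v ^ (-β)) := by
  obtain ⟨C₁, h₁⟩ := exists_lintegral_singular_le' (p := 1 / 2 - β) (q := q) (by linarith)
    (by linarith) (by linarith) (by linarith)
  obtain ⟨C₂, h₂⟩ := exists_lintegral_singular_le' (p := 1 / 2) (q := q - β) (by linarith)
    (by linarith) (by linarith) (by linarith)
  refine ⟨C₁ + C₂, fun v => ?_⟩
  have hpt : ∀ w, ENNReal.ofReal (|w| ^ (-(1 / 2) : ℝ) * jb (w - v) ^ (-q)) ≤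
      (ENNReal.ofReal (|w| ^ (-(1 / 2 - β)) * jb (w - v) ^ (-q)) +
        ENNReal.ofReal (|w| ^ (-(1 / 2) : ℝ) * jb (w - v) ^ (-(q - β)))) *
          ENNReal.ofReal (jb v ^ (-β)) := by
    intro w
    have hj := jb_pos (w - v)
    have hv := jb_pos v
    rw [← ENNReal.ofReal_add (by positivity) (by positivity), ← ENNReal.ofReal_mul (by positivity)]
    apply ENNReal.ofReal_le_ofReal
    -- At `w = 0` the convention `0 ^ (-1/2) = 0` makes the left side vanish; the exponent laws
    -- below need `w ≠ 0`.
    rcases eq_or_ne w 0 with rfl | hw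
    · have : (0 : ℝ) ^ (-(1 / 2) : ℝ) = 0 := Real.zero_rpow (by norm_num)
      rw [abs_zero, this, zero_mul]
      positivity
    have hw' : 0 < |w| := abs_pos.2 hw
    have h := jb_rpow_le_add (x := v) (y := v - w) hβ (by linarith)
    rw [sub_sub_cancel, jb_sub_comm v w] at h
    rw [Real.rpow_neg hv.le β, ← div_eq_mul_inv, le_div_iff₀ (by positivity)]
    have e1 : |w| ^ (-(1 / 2 - β)) = |w| ^ (-(1 / 2) : ℝ) * |w| ^ β := by
      rw [← Real.rpow_add hw']; ring_nf
    have e2 : jb (w - v) ^ (-(q - β)) = jb (w - v) ^ (-q) * jb (w - v) ^ β := by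
      rw [← Real.rpow_add hj]; ring_nf
    rw [e1, e2]
    calc _ ≤ |w| ^ (-(1 / 2) : ℝ) * jb (w - v) ^ (-q) * (|w| ^ β + jb (w - v) ^ β) := by gcongr
      _ = _ := by ring
  refine (lintegral_mono hpt).trans ?_
  rw [lintegral_mul_const _ (by fun_prop), lintegral_add_left (by fun_prop)]
  push_cast
  gcongr
  · exact h₁ v
  · exact h₂ v

/-- After `w = A * x ^ 2` the measure `dx` becomes a multiple of `|A| ^ (-1/2) * |w| ^ (-1/2) dw`.
The decay in `v`, with `β` short of `1/2`, is what the second integration of a two-dimensional form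
uses. -/
lemma exists_lintegral_jb_quadratic_le {q β : ℝ} (hq : 1 < q) (hβ : 0 ≤ β) (hβ2 : β < 1 / 2) :
    ∃ C : ℝ≥0, ∀ A v : ℝ, A ≠ 0 → ∫⁻ x, ENNReal.ofReal (jb (v - A * x ^ 2) ^ (-q)) ≤
      C * ENNReal.ofReal (|A| ^ (-(1 / 2) : ℝ) * jb v ^ (-β)) := by
  obtain ⟨C, hC⟩ := exists_lintegral_rpow_neg_half_jb_le hq hβ hβ2
  have hpos : ∀ A v : ℝ, 0 < A → ∫⁻ x, ENNReal.ofReal (jb (v - A * x ^ 2) ^ (-q)) ≤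
      C * ENNReal.ofReal (|A| ^ (-(1 / 2) : ℝ) * jb v ^ (-β)) := by
    intro A v hA
    rw [lintegral_even (by intro x; simp)]
    calc _ = ∫⁻ x in Ioi 0, 2 * ENNReal.ofReal (jb (v - A * x ^ 2) ^ (-q)) := by
          rw [lintegral_const_mul _ (by fun_prop)]
      _ = ∫⁻ x in Ioi 0, ENNReal.ofReal (2 * A * x) *
            (fun w => ENNReal.ofReal (|A| ^ (-(1 / 2) : ℝ)) *
              ENNReal.ofReal (|w| ^ (-(1 / 2) : ℝ) * jb (w - v) ^ (-q))) (A * x ^ 2) := by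
          refine setLIntegral_congr_fun measurableSet_Ioi fun x hx => ?_
          have hx' : 0 < x := hx
          have hj := jb_pos (A * x ^ 2 - v)
          simp only
          rw [← ENNReal.ofReal_mul (by positivity), ← ENNReal.ofReal_mul (by positivity),
            show (2 : ℝ≥0∞) = ENNReal.ofReal 2 by simp, ← ENNReal.ofReal_mul (by positivity),
            jb_sub_comm, abs_of_pos hA, abs_of_pos (by positivity : 0 < A * x ^ 2),
            Real.mul_rpow hA.le (by positivity), ← Real.rpow_natCast, ← Real.rpow_mul hx'.le]
          congr 1
          have e1 : A ^ (-(1 / 2) : ℝ) * A ^ (-(1 / 2) : ℝ) = A⁻¹ := by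
            rw [← Real.rpow_add hA]; norm_num; exact Real.rpow_neg_one A
          have e2 : x ^ (((2 : ℕ) : ℝ) * (-(1 / 2))) = x⁻¹ := by
            norm_num; exact Real.rpow_neg_one x
          rw [e2]
          calc _ = 2 * (A * A⁻¹) * (x * x⁻¹) * jb (A * x ^ (2 : ℝ) - v) ^ (-q) := by
                rw [mul_inv_cancel₀ hA.ne', mul_inv_cancel₀ hx'.ne']; norm_num
            _ = _ := by rw [← e1]; norm_num; ring
      _ = _ := setLIntegral_comp_mul_sq hA (fun w => ENNReal.ofReal (|A| ^ (-(1 / 2) : ℝ)) *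
              ENNReal.ofReal (|w| ^ (-(1 / 2) : ℝ) * jb (w - v) ^ (-q)))
      _ ≤ ∫⁻ w, ENNReal.ofReal (|A| ^ (-(1 / 2) : ℝ)) *
              ENNReal.ofReal (|w| ^ (-(1 / 2) : ℝ) * jb (w - v) ^ (-q)) :=
          setLIntegral_le_lintegral _ _
      _ ≤ ENNReal.ofReal (|A| ^ (-(1 / 2) : ℝ)) * (C * ENNReal.ofReal (jb v ^ (-β))) := by
          rw [lintegral_const_mul _ (by fun_prop)]
          gcongr
          exact hC v
      _ = _ := by rw [ENNReal.ofReal_mul (by positivity)]; ring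
  refine ⟨C, fun A v hA => ?_⟩
  rcases lt_or_gt_of_ne hA with h | h
  · have := hpos (-A) (-v) (by linarith)
    rw [abs_neg, jb_neg] at this
    refine (le_of_eq ?_).trans this
    refine lintegral_congr fun x => ?_
    rw [neg_mul, ← jb_neg (-v - _)]
    ring_nf
  · exact hpos A v h

/-- The weight `|y² - u|^{-β}` is dominated by the two singularities at `y² = u`. -/
lemma abs_sq_sub_rpow_le {β u y : ℝ} (hβ : 0 ≤ β) (h1 : y ≠ Real.sqrt u) (h2 : y ≠ -Real.sqrt u) :
    |y ^ 2 - u| ^ (-β) ≤ |y - Real.sqrt u| ^ (-(2 * β)) + |y - -Real.sqrt u| ^ (-(2 * β)) := by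
  have ha : 0 < |y - Real.sqrt u| := abs_pos.2 (sub_ne_zero.2 h1)
  have hb : 0 < |y - -Real.sqrt u| := abs_pos.2 (sub_ne_zero.2 h2)
  refine le_trans ?_ ((rpow_neg_mul_le_add ha hb hβ hβ).trans (le_of_eq (by ring_nf)))
  rw [← Real.mul_rpow ha.le hb.le, ← abs_mul]
  apply Real.rpow_le_rpow_of_nonpos (by rw [abs_mul]; positivity) _ (by linarith)
  have e : (y - Real.sqrt u) * (y - -Real.sqrt u) = y ^ 2 - Real.sqrt u ^ 2 := by ring
  rw [e]
  -- For `u ≤ 0` the default value `√u = 0` puts both singularities at the origin, where `y ^ 2 ≤ y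
  -- ^ 2 - u` suffices.
  rcases le_total 0 u with h | h
  · rw [Real.sq_sqrt h]
  · rw [Real.sqrt_eq_zero_of_nonpos h, abs_of_nonneg (by nlinarith),
      abs_of_nonneg (by nlinarith)]
    nlinarith

/-- Each root of `a * y ^ 2 = v` gives a singularity of order `2β < 1`; the factor `jb y ^ (-κ)`
supplies the decay missing at infinity. -/
lemma exists_lintegral_jb_quadratic_weight_le {β κ : ℝ} (hβ : 0 ≤ β) (hβ2 : β < 1 / 2)
    (hκ : 1 - 2 * β < κ) :
    ∃ C : ℝ≥0, ∀ a v : ℝ, a ≠ 0 →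
      ∫⁻ y, ENNReal.ofReal (jb (v - a * y ^ 2) ^ (-β) * jb y ^ (-κ)) ≤
        C * ENNReal.ofReal (|a| ^ (-β)) := by
  obtain ⟨C, hC⟩ := exists_lintegral_singular_le (p := 2 * β) (q := κ) (by linarith)
    (by linarith) (by linarith) (by linarith)
  refine ⟨C + C, fun a v ha => ?_⟩
  set r := Real.sqrt (v / a)
  have hpt : ∀ᵐ y, ENNReal.ofReal (jb (v - a * y ^ 2) ^ (-β) * jb y ^ (-κ)) ≤
      (ENNReal.ofReal (|y - r| ^ (-(2 * β)) * jb y ^ (-κ)) +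
        ENNReal.ofReal (|y - -r| ^ (-(2 * β)) * jb y ^ (-κ))) * ENNReal.ofReal (|a| ^ (-β)) := by
    filter_upwards [(Set.finite_singleton r).countable.ae_notMem volume,
      (Set.finite_singleton (-r)).countable.ae_notMem volume] with y h1 h2
    have hy := jb_rpow_nonneg y (-κ)
    have ha' : 0 < |a| := abs_pos.2 ha
    rw [← ENNReal.ofReal_add (by positivity) (by positivity), ← ENNReal.ofReal_mul (by positivity)]
    apply ENNReal.ofReal_le_ofReal
    have hs := abs_sq_sub_rpow_le hβ (u := v / a) h1 h2
    have hne : 0 < |y ^ 2 - v / a| := by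
      rw [abs_pos, sub_ne_zero]
      intro h
      have : Real.sqrt (y ^ 2) = r := by rw [h]
      rw [Real.sqrt_sq_eq_abs] at this
      rcases abs_choice y with h' | h' <;> rw [h'] at this
      · exact h1 this
      · exact h2 (by rw [mem_singleton_iff, ← this, neg_neg])
    have h3 : jb (v - a * y ^ 2) ^ (-β) ≤ |a| ^ (-β) * |y ^ 2 - v / a| ^ (-β) := by
      rw [← Real.mul_rpow ha'.le hne.le]
      apply Real.rpow_le_rpow_of_nonpos (by positivity) _ (by linarith)
      rw [← abs_mul, mul_sub, mul_div_cancel₀ _ ha, abs_sub_comm]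
      exact abs_le_jb _
    calc _ ≤ |a| ^ (-β) * (|y - r| ^ (-(2 * β)) + |y - -r| ^ (-(2 * β))) * jb y ^ (-κ) := by
          gcongr
          exact h3.trans (by gcongr)
      _ = _ := by ring
  refine (lintegral_mono_ae hpt).trans ?_
  rw [lintegral_mul_const _ (by fun_prop), lintegral_add_left (by fun_prop)]
  push_cast
  gcongr
  · exact hC r
  · exact hC (-r)

/-- Signs of `a` and `a'` are arbitrary. For an indefinite form the integral without `jb y ^ (-κ)`
diverges logarithmically, hence the weight and the loss from `1/2` to `β` in the power of `|a'|`. -/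
lemma exists_lintegral_lintegral_jb_quadratic_le {q β κ : ℝ} (hq : 1 < q) (hβ : 0 ≤ β)
    (hβ2 : β < 1 / 2) (hκ : 1 - 2 * β < κ) :
    ∃ C : ℝ≥0, ∀ a a' v : ℝ, a ≠ 0 → a' ≠ 0 →
      ∫⁻ y, ∫⁻ x, ENNReal.ofReal (jb (v - (a * x ^ 2 + a' * y ^ 2)) ^ (-q) * jb y ^ (-κ)) ≤
        C * ENNReal.ofReal (|a| ^ (-(1 / 2) : ℝ) * |a'| ^ (-β)) := by
  obtain ⟨C₁, h₁⟩ := exists_lintegral_jb_quadratic_le hq hβ hβ2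
  obtain ⟨C₂, h₂⟩ := exists_lintegral_jb_quadratic_weight_le hβ hβ2 hκ
  refine ⟨C₁ * C₂, fun a a' v ha ha' => ?_⟩
  have hin : ∀ y, ∫⁻ x, ENNReal.ofReal (jb (v - (a * x ^ 2 + a' * y ^ 2)) ^ (-q) * jb y ^ (-κ)) ≤
      C₁ * ENNReal.ofReal (|a| ^ (-(1 / 2) : ℝ)) *
        ENNReal.ofReal (jb (v - a' * y ^ 2) ^ (-β) * jb y ^ (-κ)) := by
    intro y
    have e : ∀ x, ENNReal.ofReal (jb (v - (a * x ^ 2 + a' * y ^ 2)) ^ (-q) * jb y ^ (-κ)) =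
        ENNReal.ofReal (jb ((v - a' * y ^ 2) - a * x ^ 2) ^ (-q)) * ENNReal.ofReal (jb y ^ (-κ)) := by
      intro x
      rw [← ENNReal.ofReal_mul (jb_rpow_nonneg _ _)]
      ring_nf
    simp_rw [e]
    rw [lintegral_mul_const _ (by fun_prop)]
    refine (mul_le_mul_left (h₁ a (v - a' * y ^ 2) ha) _).trans (le_of_eq ?_)
    rw [ENNReal.ofReal_mul (by positivity), ENNReal.ofReal_mul (jb_rpow_nonneg _ _)]
    ring
  refine (lintegral_mono hin).trans ?_
  rw [lintegral_const_mul _ (by fun_prop)]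
  refine (mul_le_mul_right (h₂ a' v ha') _).trans (le_of_eq ?_)
  rw [ENNReal.ofReal_mul (by positivity)]
  push_cast
  ring

/-! ### The bracket on the plane and the final integral of the comparable case. -/

/-- The Japanese bracket `√(1 + |z|²)` on the plane, for the Euclidean norm. -/
def nb (z : ℝ × ℝ) : ℝ := Real.sqrt (1 + (z.1 ^ 2 + z.2 ^ 2))

lemma nb_sq (z : ℝ × ℝ) : nb z ^ 2 = 1 + (z.1 ^ 2 + z.2 ^ 2) := Real.sq_sqrt (by positivity)

lemma jb_sq (x : ℝ) : jb x ^ 2 = 1 + x ^ 2 := Real.sq_sqrt (by positivity)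

lemma one_le_nb (z : ℝ × ℝ) : 1 ≤ nb z := by
  unfold nb; rw [Real.one_le_sqrt]; nlinarith [sq_nonneg z.1, sq_nonneg z.2]

lemma nb_pos (z : ℝ × ℝ) : 0 < nb z := lt_of_lt_of_le one_pos (one_le_nb z)

lemma jb_fst_le_nb (z : ℝ × ℝ) : jb z.1 ≤ nb z :=
  Real.sqrt_le_sqrt (by nlinarith [sq_nonneg z.2])

lemma jb_snd_le_nb (z : ℝ × ℝ) : jb z.2 ≤ nb z :=
  Real.sqrt_le_sqrt (by nlinarith [sq_nonneg z.1])

lemma nb_le_jb_add_jb (z : ℝ × ℝ) : nb z ≤ jb z.1 + jb z.2 := by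
  have h1 := jb_pos z.1
  have h2 := jb_pos z.2
  apply Real.sqrt_le_iff.2 ⟨by positivity, ?_⟩
  nlinarith [jb_sq z.1, jb_sq z.2, mul_pos h1 h2]

lemma nb_add_le (z w : ℝ × ℝ) : nb (z + w) ≤ nb z + nb w := by
  have h1 := nb_pos z
  have h2 := nb_pos w
  apply Real.sqrt_le_iff.2 ⟨by positivity, ?_⟩
  have h3 : z.1 * w.1 + z.2 * w.2 ≤ nb z * nb w := by
    refine (le_abs_self _).trans (abs_le_of_sq_le_sq ?_ (by positivity))
    rw [mul_pow, nb_sq, nb_sq]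
    nlinarith [sq_nonneg (z.1 * w.2 - z.2 * w.1), sq_nonneg z.1, sq_nonneg z.2, sq_nonneg w.1,
      sq_nonneg w.2]
  simp only [Prod.fst_add, Prod.snd_add]
  nlinarith [nb_sq z, nb_sq w]

lemma continuous_nb : Continuous nb := by unfold nb; fun_prop

@[fun_prop]
lemma measurable_nb : Measurable nb := continuous_nb.measurable

lemma nb_rpow_neg_le {p q : ℝ} (hp : 0 ≤ p) (hq : 0 ≤ q) (z : ℝ × ℝ) :
    nb z ^ (-(p + q)) ≤ jb z.1 ^ (-p) * jb z.2 ^ (-q) := by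
  rw [neg_add, Real.rpow_add (nb_pos z)]
  have h1 := Real.rpow_le_rpow_of_nonpos (jb_pos _) (jb_fst_le_nb z) (z := -p) (by linarith)
  have h2 := Real.rpow_le_rpow_of_nonpos (jb_pos _) (jb_snd_le_nb z) (z := -q) (by linarith)
  have := jb_rpow_nonneg z.1 (-p)
  have := (nb_pos z)
  gcongr

/-- The growth `jb r ^ γ` is at most `|w - r| ^ γ + jb w ^ γ`, so it lowers the exponent of one
factor by `γ`. -/
lemma exists_lintegral_singular_growth_le {p q γ : ℝ} (hγ : 0 ≤ γ) (hγ1 : γ ≤ 1) (hp : 0 < p)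
    (hγp : γ ≤ p) (hp1 : p < 1) (_hq : γ ≤ q) (hpq : 1 < p + q - γ) :
    ∃ C : ℝ≥0, ∀ r, ∫⁻ w, ENNReal.ofReal (jb r ^ γ * (|w - r| ^ (-p) * jb w ^ (-q))) ≤ C := by
  obtain ⟨C₁, h₁⟩ := exists_lintegral_singular_le (p := p - γ) (q := q) (by linarith)
    (by linarith) (by linarith) (by linarith)
  obtain ⟨C₂, h₂⟩ := exists_lintegral_singular_le (p := p) (q := q - γ) (by linarith)
    (by linarith) (by linarith) (by linarith)
  refine ⟨C₁ + C₂, fun r => ?_⟩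
  have hpt : ∀ w, ENNReal.ofReal (jb r ^ γ * (|w - r| ^ (-p) * jb w ^ (-q))) ≤
      ENNReal.ofReal (|w - r| ^ (-(p - γ)) * jb w ^ (-q)) +
        ENNReal.ofReal (|w - r| ^ (-p) * jb w ^ (-(q - γ))) := by
    intro w
    have hj := jb_pos w
    rw [← ENNReal.ofReal_add (by positivity) (by positivity)]
    apply ENNReal.ofReal_le_ofReal
    rcases eq_or_ne w r with rfl | hw
    -- The convention `0 ^ (-p) = 0`, valid for `p ≠ 0`, disposes of the point `w = r`.
    · have : (0 : ℝ) ^ (-p) = 0 := Real.zero_rpow (by linarith)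
      rw [sub_self, abs_zero, this, zero_mul, mul_zero]
      positivity
    have hw' : 0 < |w - r| := abs_pos.2 (sub_ne_zero.2 hw)
    have h := jb_rpow_le_add (x := r) (y := w) hγ hγ1
    rw [abs_sub_comm] at h
    have e1 : |w - r| ^ (-(p - γ)) = |w - r| ^ (-p) * |w - r| ^ γ := by
      rw [← Real.rpow_add hw']; ring_nf
    have e2 : jb w ^ (-(q - γ)) = jb w ^ (-q) * jb w ^ γ := by
      rw [← Real.rpow_add hj]; ring_nf
    rw [e1, e2]
    calc _ ≤ (|w - r| ^ γ + jb w ^ γ) * (|w - r| ^ (-p) * jb w ^ (-q)) := by gcongr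
      _ = _ := by ring
  refine (lintegral_mono hpt).trans ?_
  rw [lintegral_add_left (by fun_prop)]
  push_cast
  gcongr
  · exact h₁ r
  · exact h₂ r

lemma lintegral_prod_mul_le {f g : ℝ → ℝ≥0∞} (hf : Measurable f) (hg : Measurable g) {A B : ℝ≥0∞}
    (hA : ∫⁻ x, f x ≤ A) (hB : ∫⁻ y, g y ≤ B) :
    ∫⁻ z : ℝ × ℝ, f z.1 * g z.2 ≤ A * B := by

  rw [Measure.volume_eq_prod, lintegral_prod_mul hf.aemeasurable hg.aemeasurable]
  gcongr

/-- The growth in `z` is split between its coordinates. The decay `3/2 + 2θ` is then shared as `1 -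
θ/2` for the coordinate that carries the growth and `1/2 + 5θ/2` for the other, which leaves each
one-dimensional integral with an exponent above 1. -/
lemma exists_lintegral_far_frequency_le {θ : ℝ} (hθ : 0 < θ) (hθ1 : θ < 1 / 4) :
    ∃ C : ℝ≥0, ∀ z : ℝ × ℝ, ∫⁻ w : ℝ × ℝ, ENNReal.ofReal (nb z ^ (1 / 2 - θ) *
      nb w ^ (-(3 / 2 + 2 * θ)) * (|z.1 - w.1| ^ (-(1 / 2) : ℝ) *
        |z.2 - w.2| ^ (-(1 / 2 - θ / 4)))) ≤ C := by
  obtain ⟨C₁, h₁⟩ := exists_lintegral_singular_growth_le (p := 1 / 2) (q := 1 - θ / 2)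
    (γ := 1 / 2 - θ) (by linarith) (by linarith) (by linarith) (by linarith) (by linarith)
    (by linarith) (by linarith)
  obtain ⟨C₂, h₂⟩ := exists_lintegral_singular_le (p := 1 / 2 - θ / 4) (q := 1 / 2 + 5 * θ / 2)
    (by linarith) (by linarith) (by linarith) (by linarith)
  obtain ⟨C₃, h₃⟩ := exists_lintegral_singular_le (p := 1 / 2) (q := 1 / 2 + 5 * θ / 2)
    (by linarith) (by linarith) (by linarith) (by linarith)
  obtain ⟨C₄, h₄⟩ := exists_lintegral_singular_growth_le (p := 1 / 2 - θ / 4) (q := 1 - θ / 2)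
    (γ := 1 / 2 - θ) (by linarith) (by linarith) (by linarith) (by linarith) (by linarith)
    (by linarith) (by linarith)
  refine ⟨C₁ * C₂ + C₃ * C₄, fun z => ?_⟩
  set F₁ : ℝ → ℝ := fun w => jb z.1 ^ (1 / 2 - θ) * (|w - z.1| ^ (-(1 / 2) : ℝ) *
    jb w ^ (-(1 - θ / 2))) with hF₁
  set F₂ : ℝ → ℝ := fun w => |w - z.2| ^ (-(1 / 2 - θ / 4)) * jb w ^ (-(1 / 2 + 5 * θ / 2)) with hF₂
  set F₃ : ℝ → ℝ := fun w => |w - z.1| ^ (-(1 / 2) : ℝ) * jb w ^ (-(1 / 2 + 5 * θ / 2)) with hF₃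
  set F₄ : ℝ → ℝ := fun w => jb z.2 ^ (1 / 2 - θ) * (|w - z.2| ^ (-(1 / 2 - θ / 4)) *
    jb w ^ (-(1 - θ / 2))) with hF₄
  have hpt : ∀ w : ℝ × ℝ, ENNReal.ofReal (nb z ^ (1 / 2 - θ) *
      nb w ^ (-(3 / 2 + 2 * θ)) * (|z.1 - w.1| ^ (-(1 / 2) : ℝ) *
        |z.2 - w.2| ^ (-(1 / 2 - θ / 4)))) ≤
      ENNReal.ofReal (F₁ w.1) * ENNReal.ofReal (F₂ w.2) +
        ENNReal.ofReal (F₃ w.1) * ENNReal.ofReal (F₄ w.2) := by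
    intro w
    have hz1 := jb_pos z.1
    have hz2 := jb_pos z.2
    have hw1 := jb_pos w.1
    have hw2 := jb_pos w.2
    have hw := nb_pos w
    rw [← ENNReal.ofReal_mul (by positivity), ← ENNReal.ofReal_mul (by positivity),
      ← ENNReal.ofReal_add (by positivity) (by positivity), abs_sub_comm z.1, abs_sub_comm z.2]
    apply ENNReal.ofReal_le_ofReal
    have e1 : nb z ^ (1 / 2 - θ) ≤ jb z.1 ^ (1 / 2 - θ) + jb z.2 ^ (1 / 2 - θ) :=
      (Real.rpow_le_rpow (nb_pos z).le (nb_le_jb_add_jb z) (by linarith)).trans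
        (rpow_add_le_of_le_one hz1.le hz2.le (by linarith) (by linarith))
    have e2 : nb w ^ (-(3 / 2 + 2 * θ)) ≤ jb w.1 ^ (-(1 - θ / 2)) * jb w.2 ^ (-(1 / 2 + 5 * θ / 2)) :=
      (le_of_eq (by ring_nf)).trans
        (nb_rpow_neg_le (p := 1 - θ / 2) (q := 1 / 2 + 5 * θ / 2) (by linarith) (by linarith) w)
    have e3 : nb w ^ (-(3 / 2 + 2 * θ)) ≤ jb w.1 ^ (-(1 / 2 + 5 * θ / 2)) * jb w.2 ^ (-(1 - θ / 2)) :=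
      (le_of_eq (by ring_nf)).trans
        (nb_rpow_neg_le (p := 1 / 2 + 5 * θ / 2) (q := 1 - θ / 2) (by linarith) (by linarith) w)
    set P := |w.1 - z.1| ^ (-(1 / 2) : ℝ) * |w.2 - z.2| ^ (-(1 / 2 - θ / 4))
    have hP : 0 ≤ P := by positivity
    calc _ ≤ (jb z.1 ^ (1 / 2 - θ) + jb z.2 ^ (1 / 2 - θ)) * nb w ^ (-(3 / 2 + 2 * θ)) * P := by
          gcongr
      _ = jb z.1 ^ (1 / 2 - θ) * nb w ^ (-(3 / 2 + 2 * θ)) * P +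
          jb z.2 ^ (1 / 2 - θ) * nb w ^ (-(3 / 2 + 2 * θ)) * P := by ring
      _ ≤ jb z.1 ^ (1 / 2 - θ) * (jb w.1 ^ (-(1 - θ / 2)) * jb w.2 ^ (-(1 / 2 + 5 * θ / 2))) * P +
          jb z.2 ^ (1 / 2 - θ) * (jb w.1 ^ (-(1 / 2 + 5 * θ / 2)) * jb w.2 ^ (-(1 - θ / 2))) * P := by
          gcongr
      _ = _ := by simp only [hF₁, hF₂, hF₃, hF₄, P]; ring
  refine (lintegral_mono hpt).trans ?_
  rw [lintegral_add_left (by fun_prop)]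
  push_cast
  gcongr
  · exact lintegral_prod_mul_le (f := fun x => ENNReal.ofReal (F₁ x))
      (g := fun x => ENNReal.ofReal (F₂ x)) (by fun_prop) (by fun_prop) (h₁ _) (h₂ _)
  · exact lintegral_prod_mul_le (f := fun x => ENNReal.ofReal (F₃ x))
      (g := fun x => ENNReal.ofReal (F₄ x)) (by fun_prop) (by fun_prop) (h₃ _) (h₄ _)

/-- The exact factor is `1/2`, but the bound by 1 is enough. -/
lemma lintegral_comp_sub_two_mul_le (g : ℝ → ℝ≥0∞) (c : ℝ) :
    ∫⁻ x, g (c - 2 * x) ≤ ∫⁻ x, g x := by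
  have h := lintegral_image_eq_lintegral_abs_deriv_mul (MeasurableSet.univ (α := ℝ))
    (f := fun x => c - 2 * x) (f' := fun _ => -2)
    (fun x _ => by
      have := ((hasDerivAt_id x).const_mul 2).const_sub c
      simpa using this.hasDerivWithinAt (s := univ))
    (fun x _ y _ h => by simpa using h) g
  rw [image_univ, (show Function.Surjective fun x : ℝ => c - 2 * x from
    fun y => ⟨(c - y) / 2, by ring⟩).range_eq, Measure.restrict_univ] at h
  rw [h]
  apply lintegral_mono
  intro x
  exact le_mul_of_one_le_left zero_le (by norm_num)

/-! ### Resonance identity and the frequency integrals of the two cases. -/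

/-- The phase `ξ³ + η³`. -/
def phase (z : ℝ × ℝ) : ℝ := z.1 ^ 3 + z.2 ^ 3

@[fun_prop]
lemma measurable_phase : Measurable phase := by unfold phase; fun_prop

/-- This is `a³ + b³ = (a + b)³/4 + (3/4)(a + b)(a - b)²` in each coordinate. With `z` and `z₃`
fixed, `a + b` is constant and the phase is quadratic in `a - b`. -/
lemma resonance_eq (z z₂ z₃ : ℝ × ℝ) (τ : ℝ) :
    τ - (phase (z - z₃ - z₂) + phase z₂ + phase z₃) =
      (τ - phase z₃ - ((z.1 - z₃.1) ^ 3 + (z.2 - z₃.2) ^ 3) / 4) -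
        (3 / 4 * (z.1 - z₃.1) * ((z.1 - z₃.1) - 2 * z₂.1) ^ 2 +
          3 / 4 * (z.2 - z₃.2) * ((z.2 - z₃.2) - 2 * z₂.2) ^ 2) := by
  simp only [phase, Prod.fst_sub, Prod.snd_sub]
  ring

lemma exists_lintegral_smoothing_line_le {q : ℝ} (hq : 1 < q) :
    ∃ C : ℝ≥0, ∀ a v : ℝ, ∫⁻ x, ENNReal.ofReal (|a * (a - 2 * x)| *
      jb (v - 3 / 4 * a * (a - 2 * x) ^ 2) ^ (-q)) ≤ C := by
  obtain ⟨C, hC⟩ := exists_lintegral_mul_jb_quadratic_le hq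
  refine ⟨2 * C, fun a v => ?_⟩
  refine (lintegral_comp_sub_two_mul_le
    (fun y => ENNReal.ofReal (|a * y| * jb (v - 3 / 4 * a * y ^ 2) ^ (-q))) a).trans ?_
  have hpt : ∀ y, ENNReal.ofReal (|a * y| * jb (v - 3 / 4 * a * y ^ 2) ^ (-q)) ≤
      2 * ENNReal.ofReal (|3 / 4 * a * y| * jb (v - 3 / 4 * a * y ^ 2) ^ (-q)) := by
    intro y
    rw [show (2 : ℝ≥0∞) = ENNReal.ofReal 2 by simp, ← ENNReal.ofReal_mul (by norm_num)]
    apply ENNReal.ofReal_le_ofReal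
    have e : |3 / 4 * a * y| = 3 / 4 * |a * y| := by
      rw [mul_assoc, abs_mul (3 / 4 : ℝ), abs_of_pos (by norm_num : (0 : ℝ) < 3 / 4)]
    rw [e]
    have : 0 ≤ |a * y| * jb (v - 3 / 4 * a * y ^ 2) ^ (-q) :=
      mul_nonneg (abs_nonneg _) (jb_rpow_nonneg _ _)
    linarith
  refine (lintegral_mono hpt).trans ?_
  rw [lintegral_const_mul _ (by fun_prop)]
  push_cast
  gcongr
  exact hC _ _

/-- The first coordinate of `z₂` is integrated against the Jacobian factor, uniformly in the other
variables; the other brackets have exponents above 1. -/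
lemma exists_lintegral_smoothing_fst_le {q θ : ℝ} (hq : 1 < q) (hθ : 0 < θ) :
    ∃ C : ℝ≥0, ∀ (z : ℝ × ℝ) (τ : ℝ), ∫⁻ z₃ : ℝ × ℝ, ∫⁻ z₂ : ℝ × ℝ, ENNReal.ofReal
      (|(z.1 - z₃.1) * ((z.1 - z₃.1) - 2 * z₂.1)| * jb z₂.2 ^ (-(1 + 2 * θ)) *
        (jb z₃.1 ^ (-(1 + θ)) * jb z₃.2 ^ (-(1 + θ))) *
          jb (τ - (phase (z - z₃ - z₂) + phase z₂ + phase z₃)) ^ (-q)) ≤ C := by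
  obtain ⟨C₁, h₁⟩ := exists_lintegral_smoothing_line_le hq
  obtain ⟨C₂, h₂⟩ := exists_lintegral_jb_le (q := 1 + 2 * θ) (by linarith)
  obtain ⟨C₃, h₃⟩ := exists_lintegral_jb_le (q := 1 + θ) (by linarith)
  replace h₂ := h₂ 0
  replace h₃ := h₃ 0
  simp only [sub_zero] at h₂ h₃
  refine ⟨C₁ * C₂ * (C₃ * C₃), fun z τ => ?_⟩
  have hin : ∀ z₃ : ℝ × ℝ, ∫⁻ z₂ : ℝ × ℝ, ENNReal.ofReal
      (|(z.1 - z₃.1) * ((z.1 - z₃.1) - 2 * z₂.1)| * jb z₂.2 ^ (-(1 + 2 * θ)) *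
        (jb z₃.1 ^ (-(1 + θ)) * jb z₃.2 ^ (-(1 + θ))) *
          jb (τ - (phase (z - z₃ - z₂) + phase z₂ + phase z₃)) ^ (-q)) ≤
      C₁ * C₂ * (ENNReal.ofReal (jb z₃.1 ^ (-(1 + θ))) * ENNReal.ofReal (jb z₃.2 ^ (-(1 + θ)))) := by
    intro z₃
    rw [Measure.volume_eq_prod, lintegral_prod_symm _ (by fun_prop)]
    have hline : ∀ y, ∫⁻ x, ENNReal.ofReal
        (|(z.1 - z₃.1) * ((z.1 - z₃.1) - 2 * x)| * jb y ^ (-(1 + 2 * θ)) *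
        (jb z₃.1 ^ (-(1 + θ)) * jb z₃.2 ^ (-(1 + θ))) *
          jb (τ - (phase (z - z₃ - (x, y)) + phase (x, y) + phase z₃)) ^ (-q)) ≤
        C₁ * (ENNReal.ofReal (jb z₃.1 ^ (-(1 + θ))) * ENNReal.ofReal (jb z₃.2 ^ (-(1 + θ)))) *
          ENNReal.ofReal (jb y ^ (-(1 + 2 * θ))) := by
      intro y
      have e : ∀ x, ENNReal.ofReal
        (|(z.1 - z₃.1) * ((z.1 - z₃.1) - 2 * x)| * jb y ^ (-(1 + 2 * θ)) *
        (jb z₃.1 ^ (-(1 + θ)) * jb z₃.2 ^ (-(1 + θ))) *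
          jb (τ - (phase (z - z₃ - (x, y)) + phase (x, y) + phase z₃)) ^ (-q)) =
          ENNReal.ofReal (|(z.1 - z₃.1) * ((z.1 - z₃.1) - 2 * x)| *
            jb ((τ - phase z₃ - ((z.1 - z₃.1) ^ 3 + (z.2 - z₃.2) ^ 3) / 4 -
              3 / 4 * (z.2 - z₃.2) * ((z.2 - z₃.2) - 2 * y) ^ 2) -
              3 / 4 * (z.1 - z₃.1) * ((z.1 - z₃.1) - 2 * x) ^ 2) ^ (-q)) *
            (ENNReal.ofReal (jb z₃.1 ^ (-(1 + θ))) * ENNReal.ofReal (jb z₃.2 ^ (-(1 + θ))) *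
              ENNReal.ofReal (jb y ^ (-(1 + 2 * θ)))) := by
        intro x
        rw [← ENNReal.ofReal_mul (jb_rpow_nonneg _ _), ← ENNReal.ofReal_mul
          (mul_nonneg (jb_rpow_nonneg _ _) (jb_rpow_nonneg _ _)), ← ENNReal.ofReal_mul
          (mul_nonneg (abs_nonneg _) (jb_rpow_nonneg _ _)), resonance_eq]
        congr 1
        rw [sub_sub _ (3 / 4 * (z.2 - z₃.2) * _), add_comm (3 / 4 * (z.2 - z₃.2) * _)]
        ring
      simp_rw [e]
      rw [lintegral_mul_const _ (by fun_prop), mul_assoc (C₁ : ℝ≥0∞)]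
      gcongr
      exact h₁ _ _
    refine (lintegral_mono hline).trans ?_
    rw [lintegral_const_mul _ (by fun_prop)]
    refine (mul_le_mul_right h₂ _).trans (le_of_eq ?_)
    ring
  refine (lintegral_mono hin).trans ?_
  rw [lintegral_const_mul _ (by fun_prop)]
  push_cast
  gcongr
  exact lintegral_prod_mul_le (f := fun x => ENNReal.ofReal (jb x ^ (-(1 + θ))))
    (g := fun x => ENNReal.ofReal (jb x ^ (-(1 + θ)))) (by fun_prop) (by fun_prop) h₃ h₃

lemma lintegral_comp_swap (f : ℝ × ℝ → ℝ≥0∞) : ∫⁻ z : ℝ × ℝ, f z.swap = ∫⁻ z, f z :=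
  (Measure.measurePreserving_swap (μ := (volume : Measure ℝ))
    (ν := (volume : Measure ℝ))).lintegral_comp_emb MeasurableEquiv.prodComm.measurableEmbedding f

lemma phase_swap (z : ℝ × ℝ) : phase z.swap = phase z := by simp [phase, add_comm]

lemma exists_lintegral_smoothing_snd_le {q θ : ℝ} (hq : 1 < q) (hθ : 0 < θ) :
    ∃ C : ℝ≥0, ∀ (z : ℝ × ℝ) (τ : ℝ), ∫⁻ z₃ : ℝ × ℝ, ∫⁻ z₂ : ℝ × ℝ, ENNReal.ofReal
      (|(z.2 - z₃.2) * ((z.2 - z₃.2) - 2 * z₂.2)| * jb z₂.1 ^ (-(1 + 2 * θ)) *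
        (jb z₃.1 ^ (-(1 + θ)) * jb z₃.2 ^ (-(1 + θ))) *
          jb (τ - (phase (z - z₃ - z₂) + phase z₂ + phase z₃)) ^ (-q)) ≤ C := by
  obtain ⟨C, hC⟩ := exists_lintegral_smoothing_fst_le hq hθ
  refine ⟨C, fun z τ => (le_of_eq ?_).trans (hC z.swap τ)⟩
  rw [← lintegral_comp_swap]
  refine lintegral_congr fun z₃ => ?_
  rw [← lintegral_comp_swap]
  refine lintegral_congr fun z₂ => ?_
  have e : phase (z.swap - z₃ - z₂) = phase (z - z₃.swap - z₂.swap) := by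
    rw [← phase_swap]; rfl
  simp only [phase_swap, Prod.fst_swap, Prod.snd_swap, e]
  ring_nf

/-- The choice `β = 1/2 - θ/4`, `κ = θ` satisfies `κ > 1 - 2β = θ/2`, so the small weight in `z₁ -
z₂` makes the quadratic integral in `z₂` converge. -/
lemma exists_lintegral_comparable_le {q θ : ℝ} (hq : 1 < q) (hθ : 0 < θ) (hθ1 : θ < 1 / 4) :
    ∃ C : ℝ≥0, ∀ (z : ℝ × ℝ) (τ : ℝ), ∫⁻ z₃ : ℝ × ℝ, ∫⁻ z₂ : ℝ × ℝ, ENNReal.ofReal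
      (nb z ^ (1 / 2 - θ) * nb z₃ ^ (-(3 / 2 + 2 * θ)) * jb (z.2 - z₃.2 - 2 * z₂.2) ^ (-θ) *
          jb (τ - (phase (z - z₃ - z₂) + phase z₂ + phase z₃)) ^ (-q)) ≤ C := by
  obtain ⟨C₁, h₁⟩ := exists_lintegral_lintegral_jb_quadratic_le (q := q) (β := 1 / 2 - θ / 4)
    (κ := θ) hq (by linarith) (by linarith) (by linarith)
  obtain ⟨C₂, h₂⟩ := exists_lintegral_far_frequency_le hθ hθ1
  refine ⟨C₁ * 4 * C₂, fun z τ => ?_⟩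
  -- The quadratic form degenerates where a coordinate of `z₃` equals that of `z`, a null set.
  have hin : ∀ᵐ z₃ : ℝ × ℝ, ∫⁻ z₂ : ℝ × ℝ, ENNReal.ofReal
      (nb z ^ (1 / 2 - θ) * nb z₃ ^ (-(3 / 2 + 2 * θ)) * jb (z.2 - z₃.2 - 2 * z₂.2) ^ (-θ) *
          jb (τ - (phase (z - z₃ - z₂) + phase z₂ + phase z₃)) ^ (-q)) ≤
      C₁ * 4 * ENNReal.ofReal (nb z ^ (1 / 2 - θ) *
      nb z₃ ^ (-(3 / 2 + 2 * θ)) * (|z.1 - z₃.1| ^ (-(1 / 2) : ℝ) *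
        |z.2 - z₃.2| ^ (-(1 / 2 - θ / 4)))) := by
    have hne1 : ∀ᵐ z₃ : ℝ × ℝ, z₃.1 ≠ z.1 :=
      Measure.quasiMeasurePreserving_fst.ae ((finite_singleton z.1).countable.ae_notMem volume)
    have hne2 : ∀ᵐ z₃ : ℝ × ℝ, z₃.2 ≠ z.2 :=
      Measure.quasiMeasurePreserving_snd.ae ((finite_singleton z.2).countable.ae_notMem volume)
    filter_upwards [hne1, hne2] with z₃ n1 n2
    have hz := nb_pos z
    have hz3 := nb_pos z₃
    set a := z.1 - z₃.1
    set a' := z.2 - z₃.2 with ha'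
    set v := τ - phase z₃ - (a ^ 3 + a' ^ 3) / 4
    have hane : a ≠ 0 := sub_ne_zero.2 n1.symm
    have hane' : a' ≠ 0 := sub_ne_zero.2 n2.symm
    have e : ∀ z₂ : ℝ × ℝ, ENNReal.ofReal
      (nb z ^ (1 / 2 - θ) * nb z₃ ^ (-(3 / 2 + 2 * θ)) * jb (a' - 2 * z₂.2) ^ (-θ) *
          jb (τ - (phase (z - z₃ - z₂) + phase z₂ + phase z₃)) ^ (-q)) =
        ENNReal.ofReal (nb z ^ (1 / 2 - θ) * nb z₃ ^ (-(3 / 2 + 2 * θ))) *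
          ENNReal.ofReal (jb (v - (3 / 4 * a * (a - 2 * z₂.1) ^ 2 +
            3 / 4 * a' * (a' - 2 * z₂.2) ^ 2)) ^ (-q) * jb (a' - 2 * z₂.2) ^ (-θ)) := by
      intro z₂
      rw [← ENNReal.ofReal_mul (by positivity), resonance_eq]
      congr 1
      ring
    simp_rw [e]
    rw [lintegral_const_mul _ (by fun_prop), Measure.volume_eq_prod,
      lintegral_prod_symm _ (by fun_prop)]
    have hle : ∫⁻ y, ∫⁻ x, ENNReal.ofReal (jb (v - (3 / 4 * a * (a - 2 * x) ^ 2 +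
            3 / 4 * a' * (a' - 2 * y) ^ 2)) ^ (-q) * jb (a' - 2 * y) ^ (-θ)) ≤
        ∫⁻ y, ∫⁻ x, ENNReal.ofReal (jb (v - (3 / 4 * a * x ^ 2 +
            3 / 4 * a' * y ^ 2)) ^ (-q) * jb y ^ (-θ)) := by
      refine le_trans (lintegral_mono fun y => lintegral_comp_sub_two_mul_le
        (fun x => ENNReal.ofReal (jb (v - (3 / 4 * a * x ^ 2 +
            3 / 4 * a' * (a' - 2 * y) ^ 2)) ^ (-q) * jb (a' - 2 * y) ^ (-θ))) a) ?_
      exact lintegral_comp_sub_two_mul_le (fun y => ∫⁻ x, ENNReal.ofReal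
        (jb (v - (3 / 4 * a * x ^ 2 + 3 / 4 * a' * y ^ 2)) ^ (-q) * jb y ^ (-θ))) a'
    refine (mul_le_mul_right (hle.trans (h₁ _ _ v (by positivity) (by positivity))) _).trans ?_
    rw [mul_comm, mul_assoc, ← ENNReal.ofReal_mul (by positivity), mul_assoc (C₁ : ℝ≥0∞),
      show (4 : ℝ≥0∞) = ENNReal.ofReal 4 by simp, ← ENNReal.ofReal_mul (by positivity)]
    refine mul_le_mul_right (ENNReal.ofReal_le_ofReal ?_) _
    rw [abs_mul, abs_mul, Real.mul_rpow (by positivity) (by positivity),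
      Real.mul_rpow (by positivity) (by positivity), abs_of_pos (by norm_num : (0 : ℝ) < 3 / 4)]
    have hb : ∀ t : ℝ, t ≤ 1 → (3 / 4 : ℝ) ^ (-t) ≤ 4 / 3 := by
      intro t ht
      calc (3 / 4 : ℝ) ^ (-t) ≤ (3 / 4 : ℝ) ^ (-1 : ℝ) :=
            Real.rpow_le_rpow_of_exponent_ge (by norm_num) (by norm_num) (by linarith)
        _ = 4 / 3 := by rw [Real.rpow_neg_one]; norm_num
    have b1 := hb (1 / 2) (by norm_num)
    have b2 := hb (1 / 2 - θ / 4) (by linarith)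
    set W := nb z ^ (1 / 2 - θ) * nb z₃ ^ (-(3 / 2 + 2 * θ)) * (|a| ^ (-(1 / 2) : ℝ) *
      |a'| ^ (-(1 / 2 - θ / 4))) with hW
    have hW0 : 0 ≤ W := by positivity
    calc _ = ((3 / 4 : ℝ) ^ (-(1 / 2) : ℝ) * (3 / 4 : ℝ) ^ (-(1 / 2 - θ / 4))) * W := by
          rw [hW]; ring
      _ ≤ (4 / 3 * (4 / 3)) * W := by gcongr
      _ ≤ 4 * W := by nlinarith
  refine (lintegral_mono_ae hin).trans ?_
  rw [lintegral_const_mul _ (by fun_prop)]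
  push_cast
  gcongr
  exact h₂ z

/-! ### Symmetrization and splitting of the weights. -/

/-- Integral of a function of three frequencies over the plane `z₁ + z₂ + z₃ = z`. -/
def tripleIntegral (k : ℝ × ℝ → ℝ × ℝ → ℝ × ℝ → ℝ≥0∞) (z : ℝ × ℝ) : ℝ≥0∞ :=
  ∫⁻ z₃, ∫⁻ z₂, k (z - z₃ - z₂) z₂ z₃

lemma tripleIntegral_swap_left (k : ℝ × ℝ → ℝ × ℝ → ℝ × ℝ → ℝ≥0∞) (z : ℝ × ℝ) :
    tripleIntegral (fun z₁ z₂ z₃ => k z₂ z₁ z₃) z = tripleIntegral k z := by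
  refine lintegral_congr fun z₃ => ?_
  have h := lintegral_sub_left_eq_self (μ := (volume : Measure (ℝ × ℝ)))
    (fun w => k (z - z₃ - w) w z₃) (z - z₃)
  rw [← h]
  simp

lemma tripleIntegral_swap_right {k : ℝ × ℝ → ℝ × ℝ → ℝ × ℝ → ℝ≥0∞}
    (hk : Measurable fun p : (ℝ × ℝ) × (ℝ × ℝ) × (ℝ × ℝ) => k p.1 p.2.1 p.2.2) (z : ℝ × ℝ) :
    tripleIntegral (fun z₁ z₂ z₃ => k z₁ z₃ z₂) z = tripleIntegral k z := by
  unfold tripleIntegral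
  rw [lintegral_lintegral_swap]
  · simp only [sub_right_comm z]
  · exact (hk.comp (by fun_prop : Measurable fun p : (ℝ × ℝ) × (ℝ × ℝ) =>
      (z - p.1 - p.2, p.1, p.2))).aemeasurable

/-- For a symmetric integrand one may restrict to ordered frequencies. -/
lemma tripleIntegral_le_of_symmetric {k : ℝ × ℝ → ℝ × ℝ → ℝ × ℝ → ℝ≥0∞}
    (hk : Measurable fun p : (ℝ × ℝ) × (ℝ × ℝ) × (ℝ × ℝ) => k p.1 p.2.1 p.2.2)
    (h12 : ∀ a b c, k b a c = k a b c) (h23 : ∀ a b c, k a c b = k a b c) (z : ℝ × ℝ) :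
    tripleIntegral k z ≤ 6 * tripleIntegral
      (fun a b c => if nb b ≤ nb a ∧ nb c ≤ nb b then k a b c else 0) z := by
  set m : ℝ × ℝ → ℝ × ℝ → ℝ × ℝ → ℝ≥0∞ :=
    fun a b c => if nb b ≤ nb a ∧ nb c ≤ nb b then k a b c else 0 with hm
  have hmm : Measurable fun p : (ℝ × ℝ) × (ℝ × ℝ) × (ℝ × ℝ) => m p.1 p.2.1 p.2.2 :=
    have i1 : MeasurableSet {p : (ℝ × ℝ) × (ℝ × ℝ) × (ℝ × ℝ) | nb p.2.1 ≤ nb p.1} :=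
      measurableSet_le (by fun_prop) (by fun_prop)
    have i2 : MeasurableSet {p : (ℝ × ℝ) × (ℝ × ℝ) × (ℝ × ℝ) | nb p.2.2 ≤ nb p.2.1} :=
      measurableSet_le (by fun_prop) (by fun_prop)
    Measurable.ite (i1.inter i2) hk measurable_const
  have hpt : ∀ a b c, k a b c ≤ m a b c + m b a c + m a c b + m b c a + m c a b + m c b a := by
    intro a b c
    have s1 : k b a c = k a b c := h12 a b c
    have s2 : k a c b = k a b c := h23 a b c
    have s3 : k b c a = k a b c := by rw [h23 b a c, s1]
    have s4 : k c a b = k a b c := by rw [h12 a c b, s2]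
    have s5 : k c b a = k a b c := by rw [h12 b c a, s3]
    simp only [hm, s1, s2, s3, s4, s5]
    have key : ∀ x : ℝ≥0∞, ∀ p1 p2 p3 p4 p5 p6 : Prop, [Decidable p1] → [Decidable p2] →
        [Decidable p3] → [Decidable p4] → [Decidable p5] → [Decidable p6] →
        (p1 ∨ p2 ∨ p3 ∨ p4 ∨ p5 ∨ p6) →
        x ≤ (if p1 then x else 0) + (if p2 then x else 0) + (if p3 then x else 0) +
          (if p4 then x else 0) + (if p5 then x else 0) + (if p6 then x else 0) := by
      intro x p1 p2 p3 p4 p5 p6 _ _ _ _ _ _ h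
      rcases h with h | h | h | h | h | h <;> simp only [h, if_true]
      · simp only [add_assoc]; exact le_self_add
      · simp only [add_assoc]; exact le_add_left le_self_add
      · simp only [add_assoc]; exact le_add_left (le_add_left le_self_add)
      · rw [add_assoc, add_assoc]; exact le_add_left le_self_add
      · rw [add_assoc]; exact le_add_left le_self_add
      · exact le_add_self
    -- One of the six orderings of the three brackets always holds; ties are harmless for an upper
    -- bound.
    apply key
    rcases le_total (nb a) (nb b) with h1 | h1 <;> rcases le_total (nb b) (nb c) with h2 | h2 <;>
      rcases le_total (nb a) (nb c) with h3 | h3 <;> tauto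
  have hsplit : tripleIntegral k z ≤ tripleIntegral m z +
      tripleIntegral (fun a b c => m b a c) z + tripleIntegral (fun a b c => m a c b) z +
      tripleIntegral (fun a b c => m b c a) z + tripleIntegral (fun a b c => m c a b) z +
      tripleIntegral (fun a b c => m c b a) z := by
    have hmeas : ∀ f : (ℝ × ℝ) × (ℝ × ℝ) → (ℝ × ℝ) × (ℝ × ℝ) × (ℝ × ℝ), Measurable f →
        Measurable fun p => m (f p).1 (f p).2.1 (f p).2.2 := fun f hf => hmm.comp hf
    have g1 := hmeas (fun p => (z - p.1 - p.2, p.2, p.1)) (by fun_prop)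
    have g2 := hmeas (fun p => (p.2, z - p.1 - p.2, p.1)) (by fun_prop)
    have g3 := hmeas (fun p => (z - p.1 - p.2, p.1, p.2)) (by fun_prop)
    have g4 := hmeas (fun p => (p.2, p.1, z - p.1 - p.2)) (by fun_prop)
    have g5 := hmeas (fun p => (p.1, z - p.1 - p.2, p.2)) (by fun_prop)
    have g6 := hmeas (fun p => (p.1, p.2, z - p.1 - p.2)) (by fun_prop)
    simp only at g1 g2 g3 g4 g5 g6
    have sec : ∀ {F : (ℝ × ℝ) × (ℝ × ℝ) → ℝ≥0∞}, Measurable F → ∀ w, Measurable fun y => F (w, y) :=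
      fun hF w => hF.comp measurable_prodMk_left
    unfold tripleIntegral
    rw [← lintegral_add_left g1.lintegral_prod_right', ← lintegral_add_right _ g3.lintegral_prod_right',
      ← lintegral_add_right _ g4.lintegral_prod_right', ← lintegral_add_right _ g5.lintegral_prod_right',
      ← lintegral_add_right _ g6.lintegral_prod_right']
    refine lintegral_mono fun w => ?_
    simp only
    rw [← lintegral_add_left (sec g1 w), ← lintegral_add_right _ (sec g3 w),
      ← lintegral_add_right _ (sec g4 w), ← lintegral_add_right _ (sec g5 w),
      ← lintegral_add_right _ (sec g6 w)]
    exact lintegral_mono fun y => hpt _ _ _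
  have r1 : tripleIntegral (fun a b c => m b a c) z = tripleIntegral m z :=
    tripleIntegral_swap_left m z
  have r2 : tripleIntegral (fun a b c => m a c b) z = tripleIntegral m z :=
    tripleIntegral_swap_right hmm z
  have r3 : tripleIntegral (fun a b c => m b c a) z = tripleIntegral m z := by
    rw [← r2]
    exact tripleIntegral_swap_left (fun a b c => m a c b) z
  have r4 : tripleIntegral (fun a b c => m c a b) z = tripleIntegral m z := by
    rw [← r1]
    exact tripleIntegral_swap_right (k := fun a b c => m b a c)
      (hmm.comp (by fun_prop : Measurable fun p : (ℝ × ℝ) × (ℝ × ℝ) × (ℝ × ℝ) =>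
        (p.2.1, p.1, p.2.2))) z
  have r5 : tripleIntegral (fun a b c => m c b a) z = tripleIntegral m z := by
    rw [← r4]
    exact tripleIntegral_swap_left (fun a b c => m c a b) z
  rw [r1, r2, r3, r4, r5] at hsplit
  refine hsplit.trans (le_of_eq ?_)
  ring

lemma nb_rpow_nonneg (z : ℝ × ℝ) (p : ℝ) : 0 ≤ nb z ^ p := Real.rpow_nonneg (nb_pos z).le _

/-- When one frequency dominates, one of the two smoothing factors controls its square. -/
lemma nb_sq_le_of_dominant {a b : ℝ × ℝ} (h : 4 * nb b ≤ nb a) :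
    nb a ^ 2 ≤ 3 * |(a.1 + b.1) * (a.1 - b.1)| ∨ nb a ^ 2 ≤ 3 * |(a.2 + b.2) * (a.2 - b.2)| := by
  have hb := one_le_nb b
  have h16 : 16 * nb b ^ 2 ≤ nb a ^ 2 := by nlinarith
  have ha2 := nb_sq a
  have hb2 := nb_sq b
  rcases le_total (a.2 ^ 2) (a.1 ^ 2) with h' | h'
  · left
    have := le_abs_self ((a.1 + b.1) * (a.1 - b.1))
    nlinarith [sq_nonneg b.1, sq_nonneg b.2]
  · right
    have := le_abs_self ((a.2 + b.2) * (a.2 - b.2))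
    nlinarith [sq_nonneg b.1, sq_nonneg b.2]

/-- The first two terms serve `4 * nb b ≤ nb a`, one for each coordinate that may dominate; the
third serves comparable frequencies. In the latter case `nb z ^ (3 + 3θ)` is paid by `nb a` and `nb
b`, which leaves `nb a ^ (-θ)`. -/
lemma nb_weight_le {θ : ℝ} (hθ : 0 < θ) {a b c z : ℝ × ℝ}
    (hz : nb z ≤ nb a + nb b + nb c) (hba : nb b ≤ nb a) (hcb : nb c ≤ nb b) :
    nb z ^ (7 / 2 + 2 * θ) * (nb a ^ (-(3 / 2 + 2 * θ)) * nb b ^ (-(3 / 2 + 2 * θ)) *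
      nb c ^ (-(3 / 2 + 2 * θ))) ≤
    (3 ^ (7 / 2 + 2 * θ) * 3) * (|(a.1 + b.1) * (a.1 - b.1)| * jb b.2 ^ (-(1 + 2 * θ)) *
        (jb c.1 ^ (-(1 + θ)) * jb c.2 ^ (-(1 + θ)))) +
    (3 ^ (7 / 2 + 2 * θ) * 3) * (|(a.2 + b.2) * (a.2 - b.2)| * jb b.1 ^ (-(1 + 2 * θ)) *
        (jb c.1 ^ (-(1 + θ)) * jb c.2 ^ (-(1 + θ)))) +
    (3 ^ (3 + 3 * θ) * 4 ^ (3 / 2 + 2 * θ) * 2 ^ θ) *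
      (nb z ^ (1 / 2 - θ) * nb c ^ (-(3 / 2 + 2 * θ)) * jb (a.2 - b.2) ^ (-θ)) := by
  have hA := nb_pos a
  have hB := nb_pos b
  have hC := nb_pos c
  have hZ := nb_pos z
  have hZA : nb z ≤ 3 * nb a := by linarith
  have j1 := jb_pos b.1
  have j2 := jb_pos b.2
  have j3 := jb_pos c.1
  have j4 := jb_pos c.2
  have j5 := jb_pos (a.2 - b.2)
  rcases le_total (4 * nb b) (nb a) with h | h
  · have e1 : nb z ^ (7 / 2 + 2 * θ) * nb a ^ (-(3 / 2 + 2 * θ)) ≤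
        3 ^ (7 / 2 + 2 * θ) * nb a ^ 2 := by
      have := Real.rpow_le_rpow hZ.le hZA (z := 7 / 2 + 2 * θ) (by linarith)
      rw [Real.mul_rpow (by norm_num) hA.le] at this
      calc _ ≤ 3 ^ (7 / 2 + 2 * θ) * nb a ^ (7 / 2 + 2 * θ) * nb a ^ (-(3 / 2 + 2 * θ)) := by gcongr
        _ = 3 ^ (7 / 2 + 2 * θ) * (nb a ^ (7 / 2 + 2 * θ) * nb a ^ (-(3 / 2 + 2 * θ))) := by ring
        _ = _ := by
          rw [← Real.rpow_add hA, ← Real.rpow_natCast]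
          congr 2
          push_cast
          ring
    -- Half a power moves from `b` to the smaller `c`: then `c` has decay `2 + 2θ`, integrable on
    -- the plane, and `b` keeps `1 + 2θ`, integrable on a line.
    have e2 : nb b ^ (-(3 / 2 + 2 * θ)) * nb c ^ (-(3 / 2 + 2 * θ)) ≤
        nb b ^ (-(1 + 2 * θ)) * (jb c.1 ^ (-(1 + θ)) * jb c.2 ^ (-(1 + θ))) := by
      have h1 : nb b ^ (-(3 / 2 + 2 * θ)) = nb b ^ (-(1 + 2 * θ)) * nb b ^ (-(1 / 2) : ℝ) := by
        rw [← Real.rpow_add hB]; ring_nf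
      have h2 : nb b ^ (-(1 / 2) : ℝ) ≤ nb c ^ (-(1 / 2) : ℝ) :=
        Real.rpow_le_rpow_of_nonpos hC hcb (by norm_num)
      have h3 := nb_rpow_neg_le (p := 1 + θ) (q := 1 + θ) (by linarith) (by linarith) c
      calc _ ≤ nb b ^ (-(1 + 2 * θ)) * nb c ^ (-(1 / 2) : ℝ) * nb c ^ (-(3 / 2 + 2 * θ)) := by
            rw [h1]; gcongr
        _ = nb b ^ (-(1 + 2 * θ)) * nb c ^ (-(1 + θ + (1 + θ))) := by
            rw [mul_assoc, ← Real.rpow_add hC]; ring_nf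
        _ ≤ _ := by gcongr
    have e3 : nb b ^ (-(1 + 2 * θ)) ≤ jb b.1 ^ (-(1 + 2 * θ)) :=
      Real.rpow_le_rpow_of_nonpos j1 (jb_fst_le_nb b) (by linarith)
    have e4 : nb b ^ (-(1 + 2 * θ)) ≤ jb b.2 ^ (-(1 + 2 * θ)) :=
      Real.rpow_le_rpow_of_nonpos j2 (jb_snd_le_nb b) (by linarith)
    have p1 : 0 ≤ (3 ^ (7 / 2 + 2 * θ) * 3) * (|(a.1 + b.1) * (a.1 - b.1)| *
      jb b.2 ^ (-(1 + 2 * θ)) * (jb c.1 ^ (-(1 + θ)) * jb c.2 ^ (-(1 + θ)))) := by positivity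
    have p2 : 0 ≤ (3 ^ (7 / 2 + 2 * θ) * 3) * (|(a.2 + b.2) * (a.2 - b.2)| *
      jb b.1 ^ (-(1 + 2 * θ)) * (jb c.1 ^ (-(1 + θ)) * jb c.2 ^ (-(1 + θ)))) := by positivity
    have p3 : 0 ≤ (3 ^ (3 + 3 * θ) * 4 ^ (3 / 2 + 2 * θ) * 2 ^ θ) *
      (nb z ^ (1 / 2 - θ) * nb c ^ (-(3 / 2 + 2 * θ)) * jb (a.2 - b.2) ^ (-θ)) := by positivity
    have e5 : nb z ^ (7 / 2 + 2 * θ) * (nb a ^ (-(3 / 2 + 2 * θ)) * nb b ^ (-(3 / 2 + 2 * θ)) *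
      nb c ^ (-(3 / 2 + 2 * θ))) ≤ (3 ^ (7 / 2 + 2 * θ) * nb a ^ 2) *
        (nb b ^ (-(1 + 2 * θ)) * (jb c.1 ^ (-(1 + θ)) * jb c.2 ^ (-(1 + θ)))) := by
      calc _ = (nb z ^ (7 / 2 + 2 * θ) * nb a ^ (-(3 / 2 + 2 * θ))) *
            (nb b ^ (-(3 / 2 + 2 * θ)) * nb c ^ (-(3 / 2 + 2 * θ))) := by ring
        _ ≤ _ := by gcongr
    rcases nb_sq_le_of_dominant h with h' | h'
    · have : (3 ^ (7 / 2 + 2 * θ) * nb a ^ 2) *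
        (nb b ^ (-(1 + 2 * θ)) * (jb c.1 ^ (-(1 + θ)) * jb c.2 ^ (-(1 + θ)))) ≤
        (3 ^ (7 / 2 + 2 * θ) * (3 * |(a.1 + b.1) * (a.1 - b.1)|)) *
        (jb b.2 ^ (-(1 + 2 * θ)) * (jb c.1 ^ (-(1 + θ)) * jb c.2 ^ (-(1 + θ)))) := by gcongr
      linarith
    · have : (3 ^ (7 / 2 + 2 * θ) * nb a ^ 2) *
        (nb b ^ (-(1 + 2 * θ)) * (jb c.1 ^ (-(1 + θ)) * jb c.2 ^ (-(1 + θ)))) ≤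
        (3 ^ (7 / 2 + 2 * θ) * (3 * |(a.2 + b.2) * (a.2 - b.2)|)) *
        (jb b.1 ^ (-(1 + 2 * θ)) * (jb c.1 ^ (-(1 + θ)) * jb c.2 ^ (-(1 + θ)))) := by gcongr
      linarith
  · refine le_add_of_nonneg_of_le (by positivity) ?_
    have e1 : nb z ^ (7 / 2 + 2 * θ) ≤ nb z ^ (1 / 2 - θ) * (3 ^ (3 + 3 * θ) * nb a ^ (3 + 3 * θ)) := by
      rw [← Real.mul_rpow (by norm_num) hA.le]
      calc nb z ^ (7 / 2 + 2 * θ) = nb z ^ (1 / 2 - θ) * nb z ^ (3 + 3 * θ) := by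
            rw [← Real.rpow_add hZ]; ring_nf
        _ ≤ _ := by gcongr
    have e2 : nb b ^ (-(3 / 2 + 2 * θ)) ≤ 4 ^ (3 / 2 + 2 * θ) * nb a ^ (-(3 / 2 + 2 * θ)) := by
      have := Real.rpow_le_rpow_of_nonpos hA h (z := -(3 / 2 + 2 * θ)) (by linarith)
      rw [Real.mul_rpow (by norm_num) hB.le, Real.rpow_neg (by norm_num : (0 : ℝ) ≤ 4),
        inv_mul_le_iff₀ (by positivity)] at this
      exact this
    have e3 : nb a ^ (-θ) ≤ 2 ^ θ * jb (a.2 - b.2) ^ (-θ) := by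
      have h2 : jb (a.2 - b.2) ≤ 2 * nb a := by
        have h3 := jb_add_le a.2 (-b.2)
        rw [jb_neg, ← sub_eq_add_neg] at h3
        linarith [abs_le_jb a.2, jb_snd_le_nb a, jb_snd_le_nb b]
      have := Real.rpow_le_rpow_of_nonpos j5 h2 (z := -θ) (by linarith)
      rw [Real.mul_rpow (by norm_num) hA.le, Real.rpow_neg (by norm_num : (0 : ℝ) ≤ 2),
        inv_mul_le_iff₀ (by positivity)] at this
      exact this
    calc _ ≤ nb z ^ (1 / 2 - θ) * (3 ^ (3 + 3 * θ) * nb a ^ (3 + 3 * θ)) *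
          (nb a ^ (-(3 / 2 + 2 * θ)) * (4 ^ (3 / 2 + 2 * θ) * nb a ^ (-(3 / 2 + 2 * θ))) *
            nb c ^ (-(3 / 2 + 2 * θ))) := by gcongr
      _ = (3 ^ (3 + 3 * θ) * 4 ^ (3 / 2 + 2 * θ)) * nb z ^ (1 / 2 - θ) *
          nb c ^ (-(3 / 2 + 2 * θ)) * (nb a ^ (3 + 3 * θ) * nb a ^ (-(3 / 2 + 2 * θ)) *
            nb a ^ (-(3 / 2 + 2 * θ))) := by ring
      _ = (3 ^ (3 + 3 * θ) * 4 ^ (3 / 2 + 2 * θ)) * nb z ^ (1 / 2 - θ) *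
          nb c ^ (-(3 / 2 + 2 * θ)) * nb a ^ (-θ) := by
          rw [← Real.rpow_add hA, ← Real.rpow_add hA]; ring_nf
      _ ≤ (3 ^ (3 + 3 * θ) * 4 ^ (3 / 2 + 2 * θ)) * nb z ^ (1 / 2 - θ) *
          nb c ^ (-(3 / 2 + 2 * θ)) * (2 ^ θ * jb (a.2 - b.2) ^ (-θ)) := by gcongr
      _ = _ := by ring

lemma exists_tripleIntegral_le {q θ : ℝ} (hq : 1 < q) (hθ : 0 < θ) (hθ1 : θ < 1 / 4) :
    ∃ C : ℝ≥0, ∀ (z : ℝ × ℝ) (τ : ℝ), tripleIntegral (fun a b c => ENNReal.ofReal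
      (nb z ^ (7 / 2 + 2 * θ) * (nb a ^ (-(3 / 2 + 2 * θ)) * nb b ^ (-(3 / 2 + 2 * θ)) *
        nb c ^ (-(3 / 2 + 2 * θ))) * jb (τ - (phase a + phase b + phase c)) ^ (-q))) z ≤ C := by
  obtain ⟨C₁, h₁⟩ := exists_lintegral_smoothing_fst_le hq hθ
  obtain ⟨C₂, h₂⟩ := exists_lintegral_smoothing_snd_le hq hθ
  obtain ⟨C₃, h₃⟩ := exists_lintegral_comparable_le hq hθ hθ1
  set K₁ : ℝ := 3 ^ (7 / 2 + 2 * θ) * 3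
  set K₃ : ℝ := 3 ^ (3 + 3 * θ) * 4 ^ (3 / 2 + 2 * θ) * 2 ^ θ
  have hK₁0 : 0 ≤ K₁ := by positivity
  have hK₃0 : 0 ≤ K₃ := by positivity
  refine ⟨6 * (K₁.toNNReal * C₁ + K₁.toNNReal * C₂ + K₃.toNNReal * C₃), fun z τ => ?_⟩
  refine (tripleIntegral_le_of_symmetric (by fun_prop) (fun a b c => by ring_nf)
    (fun a b c => by ring_nf) z).trans ?_
  push_cast
  refine mul_le_mul_right ?_ _
  change _ ≤ ENNReal.ofReal K₁ * C₁ + ENNReal.ofReal K₁ * C₂ + ENNReal.ofReal K₃ * C₃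
  set F₁ : (ℝ × ℝ) → (ℝ × ℝ) → ℝ := fun z₃ z₂ =>
    (|(z.1 - z₃.1) * ((z.1 - z₃.1) - 2 * z₂.1)| * jb z₂.2 ^ (-(1 + 2 * θ)) *
        (jb z₃.1 ^ (-(1 + θ)) * jb z₃.2 ^ (-(1 + θ))) *
          jb (τ - (phase (z - z₃ - z₂) + phase z₂ + phase z₃)) ^ (-q)) with hF₁
  set F₂ : (ℝ × ℝ) → (ℝ × ℝ) → ℝ := fun z₃ z₂ =>
    (|(z.2 - z₃.2) * ((z.2 - z₃.2) - 2 * z₂.2)| * jb z₂.1 ^ (-(1 + 2 * θ)) *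
        (jb z₃.1 ^ (-(1 + θ)) * jb z₃.2 ^ (-(1 + θ))) *
          jb (τ - (phase (z - z₃ - z₂) + phase z₂ + phase z₃)) ^ (-q)) with hF₂
  set F₃ : (ℝ × ℝ) → (ℝ × ℝ) → ℝ := fun z₃ z₂ =>
    (nb z ^ (1 / 2 - θ) * nb z₃ ^ (-(3 / 2 + 2 * θ)) * jb (z.2 - z₃.2 - 2 * z₂.2) ^ (-θ) *
          jb (τ - (phase (z - z₃ - z₂) + phase z₂ + phase z₃)) ^ (-q)) with hF₃
  have m₁ : Measurable fun p : (ℝ × ℝ) × (ℝ × ℝ) => ENNReal.ofReal (F₁ p.1 p.2) := by fun_prop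
  have m₂ : Measurable fun p : (ℝ × ℝ) × (ℝ × ℝ) => ENNReal.ofReal (F₂ p.1 p.2) := by fun_prop
  have m₃ : Measurable fun p : (ℝ × ℝ) × (ℝ × ℝ) => ENNReal.ofReal (F₃ p.1 p.2) := by fun_prop
  have n₁ : ∀ z₃ z₂, 0 ≤ F₁ z₃ z₂ := fun z₃ z₂ => by
    have := jb_rpow_nonneg z₂.2 (-(1 + 2 * θ)); have := jb_rpow_nonneg z₃.1 (-(1 + θ))
    have := jb_rpow_nonneg z₃.2 (-(1 + θ))
    have := jb_rpow_nonneg (τ - (phase (z - z₃ - z₂) + phase z₂ + phase z₃)) (-q)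
    positivity
  have n₂ : ∀ z₃ z₂, 0 ≤ F₂ z₃ z₂ := fun z₃ z₂ => by
    have := jb_rpow_nonneg z₂.1 (-(1 + 2 * θ)); have := jb_rpow_nonneg z₃.1 (-(1 + θ))
    have := jb_rpow_nonneg z₃.2 (-(1 + θ))
    have := jb_rpow_nonneg (τ - (phase (z - z₃ - z₂) + phase z₂ + phase z₃)) (-q)
    positivity
  have n₃ : ∀ z₃ z₂, 0 ≤ F₃ z₃ z₂ := fun z₃ z₂ => by
    have := nb_pos z; have := nb_pos z₃; have := jb_pos (z.2 - z₃.2 - 2 * z₂.2)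
    have := jb_rpow_nonneg (τ - (phase (z - z₃ - z₂) + phase z₂ + phase z₃)) (-q)
    positivity
  calc _ ≤ ∫⁻ z₃ : ℝ × ℝ, ∫⁻ z₂ : ℝ × ℝ, (ENNReal.ofReal K₁ * ENNReal.ofReal (F₁ z₃ z₂) +
        ENNReal.ofReal K₁ * ENNReal.ofReal (F₂ z₃ z₂) +
          ENNReal.ofReal K₃ * ENNReal.ofReal (F₃ z₃ z₂)) := by
        refine lintegral_mono fun z₃ => lintegral_mono fun z₂ => ?_
        simp only
        split_ifs with h
        · rw [← ENNReal.ofReal_mul hK₁0, ← ENNReal.ofReal_mul hK₁0, ← ENNReal.ofReal_mul hK₃0,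
            ← ENNReal.ofReal_add (mul_nonneg hK₁0 (n₁ _ _)) (mul_nonneg hK₁0 (n₂ _ _)),
            ← ENNReal.ofReal_add (add_nonneg (mul_nonneg hK₁0 (n₁ _ _)) (mul_nonneg hK₁0 (n₂ _ _)))
              (mul_nonneg hK₃0 (n₃ _ _))]
          apply ENNReal.ofReal_le_ofReal
          have hz : nb z ≤ nb (z - z₃ - z₂) + nb z₂ + nb z₃ := by
            have t1 := nb_add_le (z - z₃ - z₂ + z₂) z₃
            have t2 := nb_add_le (z - z₃ - z₂) z₂
            rw [sub_add_cancel, sub_add_cancel] at t1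
            rw [sub_add_cancel] at t2
            linarith
          have hw := nb_weight_le hθ hz h.1 h.2
          have hj := jb_rpow_nonneg (τ - (phase (z - z₃ - z₂) + phase z₂ + phase z₃)) (-q)
          refine (mul_le_mul_of_nonneg_right hw hj).trans (le_of_eq ?_)
          simp only [hF₁, hF₂, hF₃, Prod.fst_sub, Prod.snd_sub]
          rw [show z.1 - z₃.1 - z₂.1 + z₂.1 = z.1 - z₃.1 by ring,
            show z.1 - z₃.1 - z₂.1 - z₂.1 = z.1 - z₃.1 - 2 * z₂.1 by ring,
            show z.2 - z₃.2 - z₂.2 + z₂.2 = z.2 - z₃.2 by ring,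
            show z.2 - z₃.2 - z₂.2 - z₂.2 = z.2 - z₃.2 - 2 * z₂.2 by ring]
          ring
        · exact zero_le
    _ = ENNReal.ofReal K₁ * (∫⁻ z₃ : ℝ × ℝ, ∫⁻ z₂ : ℝ × ℝ, ENNReal.ofReal (F₁ z₃ z₂)) +
        ENNReal.ofReal K₁ * (∫⁻ z₃ : ℝ × ℝ, ∫⁻ z₂ : ℝ × ℝ, ENNReal.ofReal (F₂ z₃ z₂)) +
        ENNReal.ofReal K₃ * (∫⁻ z₃ : ℝ × ℝ, ∫⁻ z₂ : ℝ × ℝ, ENNReal.ofReal (F₃ z₃ z₂)) := by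
        have sec : ∀ {F : (ℝ × ℝ) × (ℝ × ℝ) → ℝ≥0∞}, Measurable F → ∀ w,
          Measurable fun y => F (w, y) := fun hF w => hF.comp measurable_prodMk_left
        rw [← lintegral_const_mul _ m₁.lintegral_prod_right', ← lintegral_const_mul _
          m₂.lintegral_prod_right', ← lintegral_const_mul _ m₃.lintegral_prod_right',
          ← lintegral_add_left (m₁.lintegral_prod_right'.const_mul _), ← lintegral_add_right _
            (m₃.lintegral_prod_right'.const_mul _)]
        refine lintegral_congr fun z₃ => ?_
        rw [lintegral_add_right _ ((sec m₃ z₃).const_mul _),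
          lintegral_add_right _ ((sec m₂ z₃).const_mul _), lintegral_const_mul _ (sec m₁ z₃),
          lintegral_const_mul _ (sec m₂ z₃), lintegral_const_mul _ (sec m₃ z₃)]
    _ ≤ _ := by
        gcongr
        · exact h₁ z τ
        · exact h₂ z τ
        · exact h₃ z τ

/-! ### Integration in the time frequencies and the uniform kernel bound. -/

/-- The coordinates `((ξ, η), τ)` of a space-time frequency. -/
def coords (ω : SpaceTime) : (ℝ × ℝ) × ℝ := ((ω 0, ω 1), ω 2)

lemma coords_sub (ω v : SpaceTime) : coords (ω - v) = coords ω - coords v := rfl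

lemma measurePreserving_coords : MeasurePreserving coords := by
  have h1 := PiLp.volume_preserving_ofLp (Fin 3)
  have h2 := volume_preserving_piFinSuccAbove (fun _ : Fin 3 => ℝ) 2
  have h3 := (MeasurePreserving.id (volume : Measure ℝ)).prod (volume_preserving_finTwoArrow ℝ)
  have h4 := Measure.measurePreserving_swap (μ := (volume : Measure ℝ))
    (ν := (volume : Measure (ℝ × ℝ)))
  exact h4.comp (h3.comp (h2.comp h1))

@[fun_prop]
lemma measurable_coords : Measurable coords := measurePreserving_coords.measurable

lemma lintegral_coords {F : (ℝ × ℝ) × ℝ → ℝ≥0∞} (hF : Measurable F) :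
    ∫⁻ ω, F (coords ω) = ∫⁻ z, ∫⁻ t, F (z, t) := by
  rw [measurePreserving_coords.lintegral_comp hF, Measure.volume_eq_prod,
    lintegral_prod _ hF.aemeasurable]

/-- The size `⟨ζ⟩^{-p} ⟨τ - (ξ³ + η³)⟩^{-q}` in coordinates. -/
def decay (p q : ℝ) (x : (ℝ × ℝ) × ℝ) : ℝ := nb x.1 ^ (-p) * jb (x.2 - phase x.1) ^ (-q)

@[fun_prop]
lemma measurable_decay (p q : ℝ) : Measurable (decay p q) := by unfold decay; fun_prop

lemma weight_eq (s b : ℝ) (ω : SpaceTime) :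
    weight s b ω = nb (coords ω).1 ^ s * jb ((coords ω).2 - phase (coords ω).1) ^ b := rfl

lemma exists_lintegral_jb_conv_shift_le {q : ℝ} (hq : 1 < q) :
    ∃ C : ℝ≥0, ∀ x α β : ℝ, ∫⁻ t, ENNReal.ofReal (jb (x - t - α) ^ (-q) * jb (t - β) ^ (-q)) ≤
      C * ENNReal.ofReal (jb (x - (α + β)) ^ (-q)) := by
  obtain ⟨C, hC⟩ := exists_lintegral_jb_conv_le hq
  refine ⟨C, fun x α β => ?_⟩
  have h := lintegral_sub_right_eq_self (μ := volume)
    (fun t => ENNReal.ofReal (jb (x - (α + β) - t) ^ (-q) * jb t ^ (-q))) β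
  refine (le_of_eq ?_).trans (hC (x - (α + β)))
  rw [← h]
  refine lintegral_congr fun t => ?_
  ring_nf

/-- Tonelli brings both time integrals inside, so that they can be done first. -/
lemma lintegral_coords_prod {Φ : (ℝ × ℝ) × ℝ → (ℝ × ℝ) × ℝ → ℝ≥0∞}
    (hΦ : Measurable fun p : ((ℝ × ℝ) × ℝ) × ((ℝ × ℝ) × ℝ) => Φ p.1 p.2) :
    ∫⁻ p : SpaceTime × SpaceTime, Φ (coords p.1) (coords p.2) =
      ∫⁻ z₃, ∫⁻ z₂, ∫⁻ t₃, ∫⁻ t₂, Φ (z₃, t₃) (z₂, t₂) := by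
  have sec : ∀ u, Measurable (Φ u) := fun u => hΦ.comp measurable_prodMk_left
  have hΦ2 : Measurable fun u => ∫⁻ z, ∫⁻ t, Φ u (z, t) := by
    have : ∀ u, ∫⁻ z, ∫⁻ t, Φ u (z, t) = ∫⁻ v, Φ u v := fun u =>
      (lintegral_prod _ (sec u).aemeasurable).symm
    simp_rw [this]
    exact hΦ.lintegral_prod_right'
  have hΦc : Measurable fun p : SpaceTime × SpaceTime => Φ (coords p.1) (coords p.2) :=
    hΦ.comp (by fun_prop : Measurable fun p : SpaceTime × SpaceTime => (coords p.1, coords p.2))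
  rw [Measure.volume_eq_prod, lintegral_prod _ hΦc.aemeasurable]
  simp_rw [lintegral_coords (sec _)]
  rw [lintegral_coords hΦ2]
  refine lintegral_congr fun z₃ => ?_
  rw [lintegral_lintegral_swap]
  refine Measurable.aemeasurable ?_
  have : Measurable fun p : (ℝ × ℝ × ℝ) × ℝ => Φ (z₃, p.1.1) (p.1.2, p.2) :=
    hΦ.comp (by fun_prop : Measurable fun p : (ℝ × ℝ × ℝ) × ℝ => ((z₃, p.1.1), (p.1.2, p.2)))
  exact this.lintegral_prod_right'

/-- Two successive convolutions of brackets with exponent `q > 1` reproduce that bracket, with the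
phases added up. -/
lemma exists_lintegral_modulation_le {q : ℝ} (hq : 1 < q) (p r : ℝ) :
    ∃ C : ℝ≥0, ∀ (x : (ℝ × ℝ) × ℝ) (z₃ z₂ : ℝ × ℝ), ∫⁻ t₃, ∫⁻ t₂, ENNReal.ofReal
      (nb x.1 ^ r * (decay p q (x - (z₃, t₃) - (z₂, t₂)) * decay p q (z₂, t₂) *
        decay p q (z₃, t₃))) ≤ C * ENNReal.ofReal
      (nb x.1 ^ r * (nb (x.1 - z₃ - z₂) ^ (-p) * nb z₂ ^ (-p) * nb z₃ ^ (-p)) *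
          jb (x.2 - (phase (x.1 - z₃ - z₂) + phase z₂ + phase z₃)) ^ (-q)) := by
  obtain ⟨C₁, h₁⟩ := exists_lintegral_jb_conv_shift_le hq
  refine ⟨C₁ * C₁, fun x z₃ z₂ => ?_⟩
  set N : ℝ := nb x.1 ^ r * (nb (x.1 - z₃ - z₂) ^ (-p) * nb z₂ ^ (-p) * nb z₃ ^ (-p)) with hN
  have hN0 : 0 ≤ N := by
    have := nb_pos x.1; have := nb_pos (x.1 - z₃ - z₂); have := nb_pos z₂; have := nb_pos z₃
    positivity
  set α := phase (x.1 - z₃ - z₂) with hα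
  have e : ∀ t₃ t₂, ENNReal.ofReal (nb x.1 ^ r * (decay p q (x - (z₃, t₃) - (z₂, t₂)) *
      decay p q (z₂, t₂) * decay p q (z₃, t₃))) = ENNReal.ofReal N *
      ENNReal.ofReal (jb (t₃ - phase z₃) ^ (-q)) *
        ENNReal.ofReal (jb (x.2 - t₃ - t₂ - α) ^ (-q) * jb (t₂ - phase z₂) ^ (-q)) := by
    intro t₃ t₂
    rw [← ENNReal.ofReal_mul hN0, ← ENNReal.ofReal_mul (mul_nonneg hN0 (jb_rpow_nonneg _ _)), hN,
      hα]
    simp only [decay, Prod.fst_sub, Prod.snd_sub]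
    congr 1
    ring
  have i1 : ∀ t₃, ∫⁻ t₂, ENNReal.ofReal (nb x.1 ^ r * (decay p q (x - (z₃, t₃) - (z₂, t₂)) *
      decay p q (z₂, t₂) * decay p q (z₃, t₃))) ≤ C₁ * ENNReal.ofReal N *
      ENNReal.ofReal (jb (x.2 - t₃ - (α + phase z₂)) ^ (-q) * jb (t₃ - phase z₃) ^ (-q)) := by
    intro t₃
    simp_rw [e]
    rw [lintegral_const_mul _ (by fun_prop)]
    refine (mul_le_mul_right (h₁ (x.2 - t₃) α (phase z₂)) _).trans (le_of_eq ?_)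
    rw [ENNReal.ofReal_mul (jb_rpow_nonneg _ _)]
    ring
  refine (lintegral_mono i1).trans ?_
  rw [lintegral_const_mul _ (by fun_prop)]
  refine (mul_le_mul_right (h₁ x.2 (α + phase z₂) (phase z₃)) _).trans (le_of_eq ?_)
  rw [ENNReal.ofReal_mul hN0]
  push_cast
  ring

lemma exists_lintegral_decay_le {q θ : ℝ} (hq : 1 < q) (hθ : 0 < θ) (hθ1 : θ < 1 / 4) :
    ∃ C : ℝ≥0, ∀ x : (ℝ × ℝ) × ℝ, ∫⁻ p : SpaceTime × SpaceTime, ENNReal.ofReal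
      (nb x.1 ^ (7 / 2 + 2 * θ) * (decay (3 / 2 + 2 * θ) q (x - coords p.1 - coords p.2) *
        decay (3 / 2 + 2 * θ) q (coords p.2) * decay (3 / 2 + 2 * θ) q (coords p.1))) ≤ C := by
  obtain ⟨C₁, h₁⟩ := exists_lintegral_modulation_le hq (3 / 2 + 2 * θ) (7 / 2 + 2 * θ)
  obtain ⟨C₂, h₂⟩ := exists_tripleIntegral_le hq hθ hθ1
  refine ⟨C₁ * C₂, fun x => ?_⟩
  rw [lintegral_coords_prod (Φ := fun u v => ENNReal.ofReal
      (nb x.1 ^ (7 / 2 + 2 * θ) * (decay (3 / 2 + 2 * θ) q (x - u - v) *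
        decay (3 / 2 + 2 * θ) q v * decay (3 / 2 + 2 * θ) q u))) (by fun_prop)]
  refine (lintegral_mono fun z₃ => lintegral_mono fun z₂ => h₁ x z₃ z₂).trans ?_
  have hm : Measurable fun p : (ℝ × ℝ) × (ℝ × ℝ) => ENNReal.ofReal
      (nb x.1 ^ (7 / 2 + 2 * θ) * (nb (x.1 - p.1 - p.2) ^ (-(3 / 2 + 2 * θ)) *
        nb p.2 ^ (-(3 / 2 + 2 * θ)) * nb p.1 ^ (-(3 / 2 + 2 * θ))) *
          jb (x.2 - (phase (x.1 - p.1 - p.2) + phase p.2 + phase p.1)) ^ (-q)) := by fun_prop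
  have e := fun z₃ => lintegral_const_mul (μ := volume) (C₁ : ℝ≥0∞)
    (hm.comp (measurable_prodMk_left (x := z₃)))
  simp only [Function.comp_def] at e
  simp_rw [e]
  rw [lintegral_const_mul _ hm.lintegral_prod_right']
  push_cast
  gcongr
  exact h₂ x.1 x.2

/-! ### Triple convolutions and the weighted `L²` estimate. -/

section TripleConvolution

variable {E : Type*} [AddCommGroup E] [MeasureSpace E]

/-- The convolution `F₁ * F₂ * F₃` of nonnegative functions. -/
def triConv (F₁ F₂ F₃ : E → ℝ≥0∞) (ω : E) : ℝ≥0∞ :=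
  ∫⁻ p : E × E, F₁ (ω - p.1 - p.2) * F₂ p.2 * F₃ p.1

variable [MeasurableAdd₂ E] [MeasurableNeg E]

lemma measurable_triConv_integrand {F₁ F₂ F₃ : E → ℝ≥0∞} (h₁ : Measurable F₁) (h₂ : Measurable F₂)
    (h₃ : Measurable F₃) :
    Measurable fun x : E × E × E => F₁ (x.1 - x.2.1 - x.2.2) * F₂ x.2.2 * F₃ x.2.1 := by
  fun_prop

variable [SFinite (volume : Measure E)]

lemma measurable_triConv {F₁ F₂ F₃ : E → ℝ≥0∞} (h₁ : Measurable F₁) (h₂ : Measurable F₂)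
    (h₃ : Measurable F₃) : Measurable (triConv F₁ F₂ F₃) :=
  (measurable_triConv_integrand h₁ h₂ h₃).lintegral_prod_right'

lemma lintegral_triConv [(volume : Measure E).IsAddRightInvariant] {F₁ F₂ F₃ : E → ℝ≥0∞}
    (h₁ : Measurable F₁) (h₂ : Measurable F₂) (h₃ : Measurable F₃) :
    ∫⁻ ω, triConv F₁ F₂ F₃ ω = (∫⁻ ω, F₁ ω) * (∫⁻ ω, F₂ ω) * ∫⁻ ω, F₃ ω := by
  unfold triConv
  rw [lintegral_lintegral_swap (measurable_triConv_integrand h₁ h₂ h₃).aemeasurable]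
  have : ∀ p : E × E, ∫⁻ ω, F₁ (ω - p.1 - p.2) * F₂ p.2 * F₃ p.1 =
      (∫⁻ ω, F₁ ω) * (F₃ p.1 * F₂ p.2) := by
    intro p
    simp_rw [mul_assoc]
    rw [lintegral_mul_const _ (by fun_prop), mul_comm (F₂ p.2)]
    congr 1
    simp_rw [sub_sub]
    exact lintegral_sub_right_eq_self F₁ (p.1 + p.2)
  simp_rw [this]
  rw [lintegral_const_mul _ (by fun_prop), Measure.volume_eq_prod,
    lintegral_prod_mul h₃.aemeasurable h₂.aemeasurable]
  ring

end TripleConvolution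

lemma sq_lintegral_mul_le {α : Type*} [MeasurableSpace α] {μ : Measure α} {f g : α → ℝ≥0∞}
    (hf : Measurable f) (hg : Measurable g) :
    (∫⁻ x, f x * g x ∂μ) ^ 2 ≤ (∫⁻ x, f x ^ 2 ∂μ) * ∫⁻ x, g x ^ 2 ∂μ := by
  have h := ENNReal.lintegral_mul_le_Lp_mul_Lq μ Real.HolderConjugate.two_two
    hf.aemeasurable hg.aemeasurable
  simp only [Pi.mul_apply, ENNReal.rpow_ofNat] at h
  calc _ ≤ ((∫⁻ x, f x ^ 2 ∂μ) ^ (1 / 2 : ℝ) * (∫⁻ x, g x ^ 2 ∂μ) ^ (1 / 2 : ℝ)) ^ 2 := by gcongr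
    _ = _ := by
      rw [mul_pow, ← ENNReal.rpow_natCast, ← ENNReal.rpow_natCast, ← ENNReal.rpow_mul,
        ← ENNReal.rpow_mul]
      norm_num

lemma weight_pos (s b : ℝ) (ω : SpaceTime) : 0 < weight s b ω := by
  rw [weight_eq]
  exact mul_pos (Real.rpow_pos_of_pos (nb_pos _) _) (Real.rpow_pos_of_pos (jb_pos _) _)

@[fun_prop]
lemma measurable_weight (s b : ℝ) : Measurable (weight s b) := by
  have : weight s b =
      fun ω => nb (coords ω).1 ^ s * jb ((coords ω).2 - phase (coords ω).1) ^ b := rfl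
  rw [this]
  fun_prop

lemma weight_inv_sq (s b : ℝ) (ω : SpaceTime) :
    (weight s b ω)⁻¹ ^ 2 = decay (2 * s) (2 * b) (coords ω) := by
  rw [weight_eq, decay, inv_pow, mul_pow, mul_inv, ← Real.rpow_natCast, ← Real.rpow_natCast,
    ← Real.rpow_mul (nb_pos _).le, ← Real.rpow_mul (jb_pos _).le, ← Real.rpow_neg (nb_pos _).le,
    ← Real.rpow_neg (jb_pos _).le]
  push_cast
  ring_nf

/-- The trilinear convolution estimate behind the bound for `(∂ₓ + ∂_y)(u₁u₂u₃)`. -/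
theorem exists_lintegral_triConv_le {s b : ℝ} (hs : 3 / 4 < s) (hs1 : s < 1) (hb : 1 / 2 < b) :
    ∃ C : ℝ≥0, ∀ F₁ F₂ F₃ : SpaceTime → ℝ≥0∞, Measurable F₁ → Measurable F₂ → Measurable F₃ →
      ∫⁻ ω, (ENNReal.ofReal (nb (coords ω).1 ^ (1 + s)) * triConv F₁ F₂ F₃ ω) ^ 2 ≤
        C * ((∫⁻ ω, (ENNReal.ofReal (weight s b ω) * F₁ ω) ^ 2) *
          (∫⁻ ω, (ENNReal.ofReal (weight s b ω) * F₂ ω) ^ 2) *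
          ∫⁻ ω, (ENNReal.ofReal (weight s b ω) * F₃ ω) ^ 2) := by
  -- With `θ = s - 3/4` the exponents `3/2 + 2θ` and `7/2 + 2θ` are `2s` and `2(1 + s)`, the squares
  -- arising from Cauchy–Schwarz.
  obtain ⟨C, hC⟩ := exists_lintegral_decay_le (q := 2 * b) (θ := s - 3 / 4) (by linarith)
    (by linarith) (by linarith)
  refine ⟨C, fun F₁ F₂ F₃ m₁ m₂ m₃ => ?_⟩
  set W := weight s b with hW
  have hWm : Measurable W := measurable_weight s b
  have hWpos : ∀ ω, 0 < W ω := weight_pos s b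
  set G : (SpaceTime → ℝ≥0∞) → SpaceTime → ℝ≥0∞ := fun F ω => (ENNReal.ofReal (W ω) * F ω) ^ 2
    with hG
  have hGm : ∀ F, Measurable F → Measurable (G F) := fun F hF => by simp only [hG]; fun_prop
  have hcancel : ∀ (F : SpaceTime → ℝ≥0∞) ω,
      F ω = ENNReal.ofReal (W ω)⁻¹ * (ENNReal.ofReal (W ω) * F ω) := by
    intro F ω
    rw [← mul_assoc, ← ENNReal.ofReal_mul (inv_nonneg.2 (hWpos ω).le),
      inv_mul_cancel₀ (hWpos ω).ne', ENNReal.ofReal_one, one_mul]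
  have hpt : ∀ ω, (ENNReal.ofReal (nb (coords ω).1 ^ (1 + s)) * triConv F₁ F₂ F₃ ω) ^ 2 ≤
      C * triConv (G F₁) (G F₂) (G F₃) ω := by
    intro ω
    -- The factor `a` is the kernel, whose square has integral bounded uniformly in `ω`; `c` holds
    -- the weighted functions, and its square integrates to a convolution of their squares.
    set a : SpaceTime × SpaceTime → ℝ≥0∞ := fun p => ENNReal.ofReal (nb (coords ω).1 ^ (1 + s) *
      ((W (ω - p.1 - p.2))⁻¹ * (W p.2)⁻¹ * (W p.1)⁻¹)) with ha
    set c : SpaceTime × SpaceTime → ℝ≥0∞ := fun p =>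
      (ENNReal.ofReal (W (ω - p.1 - p.2)) * F₁ (ω - p.1 - p.2)) *
        (ENNReal.ofReal (W p.2) * F₂ p.2) * (ENNReal.ofReal (W p.1) * F₃ p.1) with hc
    have e1 : ENNReal.ofReal (nb (coords ω).1 ^ (1 + s)) * triConv F₁ F₂ F₃ ω =
        ∫⁻ p, a p * c p := by
      unfold triConv
      rw [← lintegral_const_mul _ (by fun_prop)]
      refine lintegral_congr fun p => ?_
      have i1 := inv_nonneg.2 (hWpos (ω - p.1 - p.2)).le
      have i2 := inv_nonneg.2 (hWpos p.2).le
      rw [hcancel F₁ (ω - p.1 - p.2), hcancel F₂ p.2, hcancel F₃ p.1]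
      simp only [ha, hc]
      rw [ENNReal.ofReal_mul (nb_rpow_nonneg _ _), ENNReal.ofReal_mul (mul_nonneg i1 i2),
        ENNReal.ofReal_mul i1, ← hcancel F₁, ← hcancel F₂, ← hcancel F₃]
      nth_rewrite 1 [hcancel F₁ (ω - p.1 - p.2), hcancel F₂ p.2, hcancel F₃ p.1]
      ring
    rw [e1]
    refine (sq_lintegral_mul_le (by fun_prop) (by fun_prop)).trans ?_
    refine mul_le_mul' ((le_of_eq ?_).trans (hC (coords ω))) (le_of_eq ?_)
    · refine lintegral_congr fun p => ?_
      simp only [ha]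
      have n1 := (hWpos (ω - p.1 - p.2)).le
      have n2 := (hWpos p.2).le
      have n3 := (hWpos p.1).le
      have n4 := nb_rpow_nonneg (coords ω).1 (1 + s)
      rw [← ENNReal.ofReal_pow (by positivity), mul_pow, mul_pow, mul_pow, hW, weight_inv_sq,
        weight_inv_sq, weight_inv_sq, ← Real.rpow_natCast, ← Real.rpow_mul (nb_pos _).le,
        coords_sub, coords_sub]
      push_cast
      ring_nf
    · refine lintegral_congr fun p => ?_
      simp only [hc, hG]
      ring
  refine (lintegral_mono hpt).trans (le_of_eq ?_)
  rw [lintegral_const_mul _ (measurable_triConv (hGm _ m₁) (hGm _ m₂) (hGm _ m₃)),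
    lintegral_triConv (hGm _ m₁) (hGm _ m₂) (hGm _ m₃)]

/-! ### Products of `L²` functions and convolutions of their Fourier transforms. -/

section Truncation

variable {V : Type*} [NormedAddCommGroup V]

/-- Truncation of a function to the ball of radius `n`. -/
def trunc (h : V → ℂ) (n : ℕ) : V → ℂ := (Metric.closedBall (0 : V) n).indicator h

lemma enorm_trunc_le (h : V → ℂ) (n : ℕ) (x : V) : ‖trunc h n x‖ₑ ≤ ‖h x‖ₑ :=
  enorm_indicator_le_enorm_self _ _

lemma norm_trunc_le (h : V → ℂ) (n : ℕ) (x : V) : ‖trunc h n x‖ ≤ ‖h x‖ :=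
  norm_indicator_le_norm_self _ _

lemma tendsto_trunc (h : V → ℂ) (x : V) : Tendsto (fun n => trunc h n x) atTop (𝓝 (h x)) := by
  refine tendsto_const_nhds.congr' ?_
  filter_upwards [eventually_ge_atTop ⌈‖x‖⌉₊] with n hn
  rw [trunc, indicator_of_mem]
  rw [mem_closedBall_zero_iff]
  exact (Nat.le_ceil _).trans (by exact_mod_cast hn)

variable [MeasurableSpace V] [OpensMeasurableSpace V]

lemma measurable_trunc {h : V → ℂ} (m : Measurable h) (n : ℕ) : Measurable (trunc h n) :=
  m.indicator Metric.isClosed_closedBall.measurableSet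

end Truncation

section L2

variable {V : Type*} [NormedAddCommGroup V] [InnerProductSpace ℝ V] [FiniteDimensional ℝ V]
  [MeasurableSpace V] [BorelSpace V]

lemma integral_fourier_mul_eq {φ h : V → ℂ} (hφ : Integrable φ) (hh : Integrable h) :
    ∫ w, 𝓕 φ w * h w = ∫ x, φ x * 𝓕 h x := by
  have := VectorFourier.integral_fourierIntegral_smul_eq_flip (e := Real.fourierChar)
    (L := innerₗ V) (μ := volume) (ν := volume) Real.continuous_fourierChar
    (by simpa using continuous_inner) hφ hh
  rw [flip_innerₗ] at this
  exact this

lemma integral_fourierInv_mul_eq {φ h : V → ℂ} (hφ : Integrable φ) (hh : Integrable h) :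
    ∫ w, 𝓕⁻ φ w * h w = ∫ x, φ x * 𝓕⁻ h x := by
  have h1 := integral_fourier_mul_eq hφ hh.comp_neg
  rw [Real.fourierInv_eq_fourier_comp_neg h, ← h1, ← integral_neg_eq_self]
  simp [Real.fourierInv_eq_fourier_neg]

/-- The inverse Fourier transform of a square integrable function, as an element of `L²`. -/
def invFourier {h : V → ℂ} (hh : MemLp h 2) : Lp ℂ 2 (volume : Measure V) := 𝓕⁻ (hh.toLp h)

lemma invFourier_toTemperedDistribution {h : V → ℂ} (hh : MemLp h 2) :
    Lp.toTemperedDistribution (invFourier hh) = 𝓕⁻ (Lp.toTemperedDistribution (hh.toLp h)) :=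
  (Lp.fourierInv_toTemperedDistribution_eq _).symm

lemma tendsto_invFourier {h : ℕ → V → ℂ} {g : V → ℂ} (hh : ∀ n, MemLp (h n) 2) (hg : MemLp g 2)
    (hlim : Tendsto (fun n => eLpNorm (h n - g) 2 volume) atTop (𝓝 0)) :
    Tendsto (fun n => invFourier (hh n)) atTop (𝓝 (invFourier hg)) := by
  have h1 : Tendsto (fun n => (hh n).toLp (h n)) atTop (𝓝 (hg.toLp g)) :=
    (Lp.tendsto_Lp_iff_tendsto_eLpNorm'' _ hh _ hg).2 hlim
  exact ((Lp.fourierTransformₗᵢ V ℂ).symm.continuous.tendsto _).comp h1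

/-- On `L¹ ∩ L²` the two definitions of the inverse Fourier transform agree. -/
lemma coeFn_invFourier {h : V → ℂ} (h1 : Integrable h) (h2 : MemLp h 2) :
    invFourier h2 =ᵐ[volume] 𝓕⁻ h := by
  have hcont : Continuous (𝓕⁻ h) := by
    rw [Real.fourierInv_eq_fourier_comp_neg]
    exact VectorFourier.fourierIntegral_continuous Real.continuous_fourierChar
      (by simpa using continuous_inner) h1.comp_neg
  refine ae_eq_of_integral_contDiff_smul_eq ((Lp.memLp _).locallyIntegrable (by norm_num))
    hcont.locallyIntegrable fun φ hφ hc => ?_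
  have hc' : HasCompactSupport (fun p => (φ p : ℂ)) := hc.comp_left Complex.ofReal_zero
  have hφ' : ContDiff ℝ _ (fun p => (φ p : ℂ)) := Complex.ofRealCLM.contDiff.comp hφ
  set ψ : 𝓢(V, ℂ) := hc'.toSchwartzMap hφ' with hψ
  have e1 : (Lp.toTemperedDistribution (invFourier h2)) ψ =
      ∫ x, 𝓕⁻ (ψ : V → ℂ) x * h x := by
    rw [invFourier_toTemperedDistribution, TemperedDistribution.fourierInv_apply,
      Lp.toTemperedDistribution_apply]
    refine integral_congr_ae ?_
    filter_upwards [h2.coeFn_toLp] with x hx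
    rw [hx, SchwartzMap.fourierInv_coe, smul_eq_mul]
  rw [integral_fourierInv_mul_eq ψ.integrable h1, Lp.toTemperedDistribution_apply] at e1
  simpa [hψ] using e1

/-- Dominated convergence for `‖f n - g‖²`, with dominating function `(2B)²`. -/
lemma tendsto_eLpNorm_two_of_dominated {α : Type*} [MeasurableSpace α] {μ : Measure α}
    {f : ℕ → α → ℂ} {g : α → ℂ} {B : α → ℝ≥0∞} (hf : ∀ n, Measurable (f n)) (hg : Measurable g)
    (hB : ∫⁻ x, B x ^ 2 ∂μ ≠ ∞) (hfB : ∀ n x, ‖f n x‖ₑ ≤ B x) (hgB : ∀ x, ‖g x‖ₑ ≤ B x)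
    (hlim : ∀ᵐ x ∂μ, Tendsto (fun n => f n x) atTop (𝓝 (g x))) :
    Tendsto (fun n => eLpNorm (f n - g) 2 μ) atTop (𝓝 0) := by
  have h := tendsto_lintegral_of_dominated_convergence (μ := μ) (f := fun _ => 0)
    (F := fun n x => ‖f n x - g x‖ₑ ^ 2) (fun x => 4 * B x ^ 2)
    (fun n => ((hf n).sub hg).enorm.pow_const 2) (fun n => Eventually.of_forall fun x => by
      calc ‖f n x - g x‖ₑ ^ 2 ≤ (B x + B x) ^ 2 := by
            gcongr
            exact (enorm_sub_le).trans (add_le_add (hfB n x) (hgB x))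
        _ = 4 * B x ^ 2 := by ring)
    (by rw [lintegral_const_mul' _ _ (by simp)]; finiteness) (by
      filter_upwards [hlim] with x hx
      have h1 : Tendsto (fun n => f n x - g x) atTop (𝓝 0) := by
        simpa using hx.sub_const (g x)
      have h2 := (ENNReal.continuous_pow 2).tendsto _ |>.comp h1.enorm
      simpa [Function.comp_def] using h2)
  have h3 := (ENNReal.continuous_rpow_const (y := (1 / 2 : ℝ))).tendsto _ |>.comp h
  simp only [lintegral_zero] at h3
  rw [ENNReal.zero_rpow_of_pos (by norm_num)] at h3
  refine h3.congr fun n => ?_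
  rw [eLpNorm_eq_lintegral_rpow_enorm_toReal (by norm_num) (by norm_num)]
  simp

lemma Lp_exists_subseq_tendsto_ae {α : Type*} [MeasurableSpace α] {μ : Measure α}
    {u : ℕ → Lp ℂ 2 μ} {v : Lp ℂ 2 μ} (h : Tendsto u atTop (𝓝 v)) :
    ∃ ns : ℕ → ℕ, StrictMono ns ∧
      ∀ᵐ x ∂μ, Tendsto (fun n => u (ns n) x) atTop (𝓝 (v x)) := by
  rw [Lp.tendsto_Lp_iff_tendsto_eLpNorm'] at h
  exact (tendstoInMeasure_of_tendsto_eLpNorm (by norm_num)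
    (fun n => (Lp.memLp (u n)).aestronglyMeasurable) (Lp.memLp v).aestronglyMeasurable
    h).exists_seq_tendsto_ae

/-- The convolution `h₁ * h₂ * h₃` of complex-valued functions. -/
def cconv (h₁ h₂ h₃ : V → ℂ) (v : V) : ℂ :=
  ∫ p : V × V, h₁ (v - p.1 - p.2) * h₂ p.2 * h₃ p.1

lemma measurable_cconv_integrand {h₁ h₂ h₃ : V → ℂ} (m₁ : Measurable h₁) (m₂ : Measurable h₂)
    (m₃ : Measurable h₃) :
    Measurable fun x : V × V × V => h₁ (x.1 - x.2.1 - x.2.2) * h₂ x.2.2 * h₃ x.2.1 := by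
  fun_prop

lemma measurable_cconv {h₁ h₂ h₃ : V → ℂ} (m₁ : Measurable h₁) (m₂ : Measurable h₂)
    (m₃ : Measurable h₃) : Measurable (cconv h₁ h₂ h₃) :=
  (measurable_cconv_integrand m₁ m₂ m₃).stronglyMeasurable.integral_prod_right'.measurable

lemma enorm_cconv_le (h₁ h₂ h₃ : V → ℂ) (v : V) :
    ‖cconv h₁ h₂ h₃ v‖ₑ ≤ triConv (fun x => ‖h₁ x‖ₑ) (fun x => ‖h₂ x‖ₑ) (fun x => ‖h₃ x‖ₑ) v := by
  refine (enorm_integral_le_lintegral_enorm _).trans (le_of_eq ?_)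
  simp only [enorm_mul, triConv]

lemma integrable_cconv_integrand {h₁ h₂ h₃ : V → ℂ} (m₁ : Measurable h₁) (m₂ : Measurable h₂)
    (m₃ : Measurable h₃) (i₁ : Integrable h₁) (i₂ : Integrable h₂) (i₃ : Integrable h₃) :
    Integrable (fun x : V × V × V => h₁ (x.1 - x.2.1 - x.2.2) * h₂ x.2.2 * h₃ x.2.1) := by
  refine ⟨(measurable_cconv_integrand m₁ m₂ m₃).aestronglyMeasurable, ?_⟩
  rw [HasFiniteIntegral, Measure.volume_eq_prod,
    lintegral_prod _ (measurable_cconv_integrand m₁ m₂ m₃).enorm.aemeasurable]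
  simp only [enorm_mul]
  have := lintegral_triConv (E := V) m₁.enorm m₂.enorm m₃.enorm
  simp only [triConv] at this
  rw [this]
  exact ENNReal.mul_lt_top (ENNReal.mul_lt_top i₁.2 i₂.2) i₃.2

lemma integrable_cconv {h₁ h₂ h₃ : V → ℂ} (m₁ : Measurable h₁) (m₂ : Measurable h₂)
    (m₃ : Measurable h₃) (i₁ : Integrable h₁) (i₂ : Integrable h₂) (i₃ : Integrable h₃) :
    Integrable (cconv h₁ h₂ h₃) :=
  (integrable_cconv_integrand m₁ m₂ m₃ i₁ i₂ i₃).integral_prod_left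

/-- For integrable functions Fubini applies, and the character factors over the three frequencies.
-/
lemma fourierInv_cconv {h₁ h₂ h₃ : V → ℂ} (m₁ : Measurable h₁) (m₂ : Measurable h₂)
    (m₃ : Measurable h₃) (i₁ : Integrable h₁) (i₂ : Integrable h₂) (i₃ : Integrable h₃) (x : V) :
    𝓕⁻ (cconv h₁ h₂ h₃) x = 𝓕⁻ h₁ x * 𝓕⁻ h₂ x * 𝓕⁻ h₃ x := by
  have hQ := integrable_cconv_integrand m₁ m₂ m₃ i₁ i₂ i₃
  set e : V → ℂ := fun v => (Real.fourierChar (inner ℝ v x) : ℂ) with he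
  have hem : Measurable e := by
    have : Continuous e := by
      simp only [he]
      exact continuous_subtype_val.comp (Real.continuous_fourierChar.comp (by fun_prop))
    exact this.measurable
  have hen : ∀ v, ‖e v‖ = 1 := fun v => Circle.norm_coe _
  have hadd : ∀ v w, e (v + w) = e v * e w := fun v w => by
    simp [he, inner_add_left, AddChar.map_add_eq_mul]
  have hinv : ∀ f : V → ℂ, 𝓕⁻ f x = ∫ v, e v * f v := fun f => by
    rw [Real.fourierInv_eq]; rfl
  have hQe : Integrable (fun y : V × V × V => e y.1 * (h₁ (y.1 - y.2.1 - y.2.2) * h₂ y.2.2 *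
      h₃ y.2.1)) := by
    refine hQ.mono ((hem.comp measurable_fst).mul
      (measurable_cconv_integrand m₁ m₂ m₃)).aestronglyMeasurable (Eventually.of_forall fun y => ?_)
    rw [norm_mul, hen, one_mul]
  calc 𝓕⁻ (cconv h₁ h₂ h₃) x
      = ∫ v, ∫ p : V × V, e v * (h₁ (v - p.1 - p.2) * h₂ p.2 * h₃ p.1) := by
        rw [hinv]
        simp only [cconv, integral_const_mul]
    _ = ∫ p : V × V, ∫ v, e v * (h₁ (v - p.1 - p.2) * h₂ p.2 * h₃ p.1) :=
        integral_integral_swap hQe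
    _ = ∫ p : V × V, 𝓕⁻ h₁ x * ((e p.1 * h₃ p.1) * (e p.2 * h₂ p.2)) := by
        refine integral_congr_ae (Eventually.of_forall fun p => ?_)
        have := integral_sub_right_eq_self (μ := (volume : Measure V))
          (fun v => e (v + (p.1 + p.2)) * (h₁ v * h₂ p.2 * h₃ p.1)) (p.1 + p.2)
        simp only [sub_add_cancel] at this
        simp only [← sub_sub] at this
        simp only
        rw [this, hinv, ← integral_mul_const]
        refine integral_congr_ae (Eventually.of_forall fun v => ?_)
        simp only [hadd]
        ring
    _ = _ := by
        rw [integral_const_mul, Measure.volume_eq_prod, integral_prod_mul (fun v => e v * h₃ v)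
          (fun v => e v * h₂ v), ← hinv, ← hinv]
        ring

lemma memLp_trunc {h : V → ℂ} (hh : MemLp h 2) (n : ℕ) : MemLp (trunc h n) 2 :=
  hh.indicator Metric.isClosed_closedBall.measurableSet

lemma integrable_trunc {h : V → ℂ} (hh : MemLp h 2) (n : ℕ) : Integrable (trunc h n) := by
  rw [trunc, integrable_indicator_iff Metric.isClosed_closedBall.measurableSet]
  exact (hh.locallyIntegrable (by norm_num)).integrableOn_isCompact (isCompact_closedBall _ _)

lemma lintegral_enorm_sq_lt_top {α : Type*} [MeasurableSpace α] {μ : Measure α} {h : α → ℂ}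
    (hh : MemLp h 2 μ) : ∫⁻ x, ‖h x‖ₑ ^ 2 ∂μ < ∞ := by
  have := lintegral_rpow_enorm_lt_top_of_eLpNorm_lt_top (by norm_num) (by norm_num) hh.2
  simpa using this

lemma memLp_two_of_lintegral {α : Type*} [MeasurableSpace α] {μ : Measure α} {h : α → ℂ}
    {B : α → ℝ≥0∞} (hm : AEStronglyMeasurable h μ) (hB : ∫⁻ x, B x ^ 2 ∂μ ≠ ∞)
    (hle : ∀ x, ‖h x‖ₑ ≤ B x) : MemLp h 2 μ := by
  refine ⟨hm, ?_⟩
  rw [eLpNorm_lt_top_iff_lintegral_rpow_enorm_lt_top (by norm_num) (by norm_num)]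
  refine lt_of_le_of_lt (lintegral_mono fun x => ?_) (lt_top_iff_ne_top.2 hB)
  simp only [ENNReal.toReal_ofNat, ENNReal.rpow_ofNat]
  gcongr
  exact hle x

lemma tendsto_invFourier_trunc {h : V → ℂ} (m : Measurable h) (hh : MemLp h 2) :
    Tendsto (fun n => invFourier (memLp_trunc hh n)) atTop (𝓝 (invFourier hh)) :=
  tendsto_invFourier _ _ (tendsto_eLpNorm_two_of_dominated (measurable_trunc m) m
    (lintegral_enorm_sq_lt_top hh).ne (enorm_trunc_le h) (fun _ => le_rfl)
    (Eventually.of_forall (tendsto_trunc h)))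

lemma tendsto_cconv_trunc {h₁ h₂ h₃ : V → ℂ} (m₁ : Measurable h₁) (m₂ : Measurable h₂)
    (m₃ : Measurable h₃) {v : V}
    (hv : triConv (fun x => ‖h₁ x‖ₑ) (fun x => ‖h₂ x‖ₑ) (fun x => ‖h₃ x‖ₑ) v < ∞) :
    Tendsto (fun n => cconv (trunc h₁ n) (trunc h₂ n) (trunc h₃ n) v) atTop
      (𝓝 (cconv h₁ h₂ h₃ v)) := by
  have hmeas : ∀ {k₁ k₂ k₃ : V → ℂ}, Measurable k₁ → Measurable k₂ → Measurable k₃ →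
      Measurable fun p : V × V => k₁ (v - p.1 - p.2) * k₂ p.2 * k₃ p.1 := by
    intro k₁ k₂ k₃ q₁ q₂ q₃
    fun_prop
  refine tendsto_integral_of_dominated_convergence
    (fun p => ‖h₁ (v - p.1 - p.2) * h₂ p.2 * h₃ p.1‖) (fun n => (hmeas (measurable_trunc m₁ n)
      (measurable_trunc m₂ n) (measurable_trunc m₃ n)).aestronglyMeasurable) ?_ ?_ ?_
  · refine Integrable.norm ⟨(hmeas m₁ m₂ m₃).aestronglyMeasurable, ?_⟩
    simpa only [HasFiniteIntegral, enorm_mul, triConv] using hv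
  · refine fun n => Eventually.of_forall fun p => ?_
    simp only [norm_mul]
    gcongr <;> exact norm_trunc_le _ _ _
  · exact Eventually.of_forall fun p =>
      ((tendsto_trunc h₁ _).mul (tendsto_trunc h₂ _)).mul (tendsto_trunc h₃ _)

lemma triConv_mono {F₁ F₂ F₃ G₁ G₂ G₃ : V → ℝ≥0∞} (h₁ : ∀ x, F₁ x ≤ G₁ x) (h₂ : ∀ x, F₂ x ≤ G₂ x)
    (h₃ : ∀ x, F₃ x ≤ G₃ x) (v : V) : triConv F₁ F₂ F₃ v ≤ triConv G₁ G₂ G₃ v :=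
  lintegral_mono fun _ => mul_le_mul' (mul_le_mul' (h₁ _) (h₂ _)) (h₃ _)

lemma memLp_cconv {h₁ h₂ h₃ : V → ℂ} (m₁ : Measurable h₁) (m₂ : Measurable h₂)
    (m₃ : Measurable h₃) (hT : ∫⁻ v, triConv (fun x => ‖h₁ x‖ₑ) (fun x => ‖h₂ x‖ₑ)
      (fun x => ‖h₃ x‖ₑ) v ^ 2 ≠ ∞) : MemLp (cconv h₁ h₂ h₃) 2 :=
  memLp_two_of_lintegral (measurable_cconv m₁ m₂ m₃).aestronglyMeasurable hT
    (enorm_cconv_le h₁ h₂ h₃)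

/-- The product of three `L²` functions is the inverse Fourier transform of the convolution of
their Fourier transforms, if this convolution converges absolutely in `L²`. -/
theorem fourierInv_cconv_ae_eq {h₁ h₂ h₃ : V → ℂ} (m₁ : Measurable h₁) (m₂ : Measurable h₂)
    (m₃ : Measurable h₃) (l₁ : MemLp h₁ 2) (l₂ : MemLp h₂ 2) (l₃ : MemLp h₃ 2)
    (hT : ∫⁻ v, triConv (fun x => ‖h₁ x‖ₑ) (fun x => ‖h₂ x‖ₑ) (fun x => ‖h₃ x‖ₑ) v ^ 2 ≠ ∞) :
    invFourier (memLp_cconv m₁ m₂ m₃ hT) =ᵐ[volume] fun x =>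
      invFourier l₁ x * invFourier l₂ x * invFourier l₃ x := by
  set T := triConv (fun x => ‖h₁ x‖ₑ) (fun x => ‖h₂ x‖ₑ) (fun x => ‖h₃ x‖ₑ)
  have hTm : Measurable T := measurable_triConv m₁.enorm m₂.enorm m₃.enorm
  set H : ℕ → V → ℂ := fun n => cconv (trunc h₁ n) (trunc h₂ n) (trunc h₃ n)
  have hHm : ∀ n, Measurable (H n) := fun n =>
    measurable_cconv (measurable_trunc m₁ n) (measurable_trunc m₂ n) (measurable_trunc m₃ n)
  have hHB : ∀ n v, ‖H n v‖ₑ ≤ T v := fun n v => (enorm_cconv_le _ _ _ v).trans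
    (triConv_mono (enorm_trunc_le _ _) (enorm_trunc_le _ _) (enorm_trunc_le _ _) v)
  have hH2 : ∀ n, MemLp (H n) 2 := fun n =>
    memLp_two_of_lintegral (hHm n).aestronglyMeasurable hT (hHB n)
  have hlim : Tendsto (fun n => invFourier (hH2 n)) atTop
      (𝓝 (invFourier (memLp_cconv m₁ m₂ m₃ hT))) := by
    refine tendsto_invFourier _ _ (tendsto_eLpNorm_two_of_dominated hHm
      (measurable_cconv m₁ m₂ m₃) hT hHB (enorm_cconv_le h₁ h₂ h₃) ?_)
    filter_upwards [ae_lt_top (hTm.pow_const 2) hT] with v hv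
    exact tendsto_cconv_trunc m₁ m₂ m₃ (by simpa using hv)
  -- Nested subsequences turn `L²` convergence of the three factors and of the product into
  -- simultaneous convergence almost everywhere.
  obtain ⟨n₁, hn₁, a₁⟩ := Lp_exists_subseq_tendsto_ae (tendsto_invFourier_trunc m₁ l₁)
  obtain ⟨n₂, hn₂, a₂⟩ := Lp_exists_subseq_tendsto_ae
    ((tendsto_invFourier_trunc m₂ l₂).comp hn₁.tendsto_atTop)
  obtain ⟨n₃, hn₃, a₃⟩ := Lp_exists_subseq_tendsto_ae
    ((tendsto_invFourier_trunc m₃ l₃).comp (hn₁.comp hn₂).tendsto_atTop)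
  obtain ⟨n₄, hn₄, a₄⟩ := Lp_exists_subseq_tendsto_ae
    (hlim.comp ((hn₁.comp hn₂).comp hn₃).tendsto_atTop)
  have heq : ∀ᵐ x, ∀ n, invFourier (hH2 n) x = invFourier (memLp_trunc l₁ n) x *
      invFourier (memLp_trunc l₂ n) x * invFourier (memLp_trunc l₃ n) x := by
    refine ae_all_iff.2 fun n => ?_
    have j₁ := integrable_trunc l₁ n
    have j₂ := integrable_trunc l₂ n
    have j₃ := integrable_trunc l₃ n
    have q₁ := measurable_trunc m₁ n
    have q₂ := measurable_trunc m₂ n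
    have q₃ := measurable_trunc m₃ n
    filter_upwards [coeFn_invFourier (integrable_cconv q₁ q₂ q₃ j₁ j₂ j₃) (hH2 n),
      coeFn_invFourier j₁ (memLp_trunc l₁ n), coeFn_invFourier j₂ (memLp_trunc l₂ n),
      coeFn_invFourier j₃ (memLp_trunc l₃ n)] with x e₀ e₁ e₂ e₃
    rw [e₁, e₂, e₃]
    exact e₀.trans (fourierInv_cconv q₁ q₂ q₃ j₁ j₂ j₃ x)
  filter_upwards [a₁, a₂, a₃, a₄, heq] with x b₁ b₂ b₃ b₄ e
  have c₁ := b₁.comp ((hn₂.comp hn₃).comp hn₄).tendsto_atTop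
  have c₂ := b₂.comp (hn₃.comp hn₄).tendsto_atTop
  have c₃ := b₃.comp hn₄.tendsto_atTop
  refine tendsto_nhds_unique b₄ (((c₁.mul c₂).mul c₃).congr fun n => ?_)
  exact (e _).symm

end L2

/-! ### Change of Fourier normalization by the dilation `2π`, and the derivative. -/

section Dilation

variable {V : Type*} [NormedAddCommGroup V] [NormedSpace ℝ V] [FiniteDimensional ℝ V]
  [MeasureSpace V] [BorelSpace V] [(volume : Measure V).IsAddHaarMeasure]

lemma lintegral_comp_smul_le {c : ℝ} (hc : 1 ≤ c) {f : V → ℝ≥0∞} (hf : Measurable f) :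
    ∫⁻ x, f (c • x) ≤ ∫⁻ x, f x := by
  rw [← lintegral_map (g := fun x : V => c • x) hf (by fun_prop),
    Measure.map_addHaar_smul volume (by positivity), lintegral_smul_measure]
  refine mul_le_of_le_one_left zero_le ?_
  rw [abs_of_pos (by positivity), ENNReal.ofReal_le_one]
  exact inv_le_one_of_one_le₀ (one_le_pow₀ hc)

/-- Rescaling both integration variables gives a Jacobian at most 1, so the exact power of `c` need
not be tracked. -/
lemma triConv_comp_smul_le {c : ℝ} (hc : 1 ≤ c) {F₁ F₂ F₃ : V → ℝ≥0∞} (m₁ : Measurable F₁)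
    (m₂ : Measurable F₂) (m₃ : Measurable F₃) (v : V) :
    triConv (fun x => F₁ (c • x)) (fun x => F₂ (c • x)) (fun x => F₃ (c • x)) v ≤
      triConv F₁ F₂ F₃ (c • v) := by
  have hm : Measurable fun p : V × V => F₁ (c • v - p.1 - p.2) * F₂ p.2 * F₃ p.1 := by fun_prop
  have : (volume : Measure (V × V)).IsAddHaarMeasure :=
    inferInstanceAs ((volume : Measure V).prod (volume : Measure V)).IsAddHaarMeasure
  refine (le_of_eq ?_).trans (lintegral_comp_smul_le hc hm)
  simp only [triConv, smul_sub, Prod.smul_fst, Prod.smul_snd]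

end Dilation

lemma eLpNorm_two_eq {α : Type*} [MeasurableSpace α] {μ : Measure α} (f : α → ℂ) :
    eLpNorm f 2 μ = (∫⁻ x, ‖f x‖ₑ ^ 2 ∂μ) ^ (1 / 2 : ℝ) := by
  rw [eLpNorm_eq_lintegral_rpow_enorm_toReal (by norm_num) (by norm_num)]
  simp

lemma IsFunction.congr {T : 𝓢'(SpaceTime, ℂ)} {f g : SpaceTime → ℂ} (hf : IsFunction T f)
    (h : f =ᵐ[volume] g) : IsFunction T g := by
  refine ⟨fun x => (hf.1 x).congr h, fun φ => ?_⟩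
  have e : (fun p => φ p * f p) =ᵐ[volume] fun p => φ p * g p := by
    filter_upwards [h] with p hp
    rw [hp]
  exact ⟨(hf.2 φ).1.congr e, (hf.2 φ).2.trans (integral_congr_ae e)⟩

lemma IsFunction.dist_eq {T T' : 𝓢'(SpaceTime, ℂ)} {f : SpaceTime → ℂ} (h : IsFunction T f)
    (h' : IsFunction T' f) : T = T' := by
  ext φ
  rw [(h.2 φ).2, (h'.2 φ).2]

lemma integrable_schwartz_mul {f : SpaceTime → ℂ} (hf : MemLp f 2) (φ : 𝓢(SpaceTime, ℂ)) :
    Integrable (fun p => φ p * f p) :=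
  (φ.memLp 2).integrable_mul hf

lemma isFunction_of_memLp {T : 𝓢'(SpaceTime, ℂ)} {f : SpaceTime → ℂ} (hf : MemLp f 2)
    (h : ∀ φ : 𝓢(SpaceTime, ℂ), T φ = ∫ p, φ p * f p) : IsFunction T f :=
  ⟨hf.locallyIntegrable (by norm_num), fun φ => ⟨integrable_schwartz_mul hf φ, h φ⟩⟩

lemma isFunction_toTemperedDistribution (F : Lp ℂ 2 (volume : Measure SpaceTime)) :
    IsFunction (Lp.toTemperedDistribution F) F :=
  isFunction_of_memLp (Lp.memLp F) fun φ => Lp.toTemperedDistribution_apply F φ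

/-- The dilation `φ ↦ φ(c ·)` of Schwartz functions. -/
def dilate {c : ℝ} (hc : c ≠ 0) : 𝓢(SpaceTime, ℂ) →L[ℂ] 𝓢(SpaceTime, ℂ) :=
  SchwartzMap.compCLMOfContinuousLinearEquiv ℂ
    (ContinuousLinearEquiv.smulLeft (Units.mk0 c hc) : SpaceTime ≃L[ℝ] SpaceTime)

lemma dilate_apply {c : ℝ} (hc : c ≠ 0) (φ : 𝓢(SpaceTime, ℂ)) (x : SpaceTime) :
    dilate hc φ x = φ (c • x) := rfl

lemma two_pi_ne_zero : (2 * Real.pi : ℝ) ≠ 0 := Real.two_pi_pos.ne'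

lemma one_le_two_pi : (1 : ℝ) ≤ 2 * Real.pi := by linarith [Real.pi_gt_three]

/-- The Jacobian of the dilation by `(2π)⁻¹` on space-time. -/
def jac : ℝ := |((2 * Real.pi) ^ Module.finrank ℝ SpaceTime)⁻¹|

lemma jac_ne_zero : (jac : ℂ) ≠ 0 := by
  have := Real.pi_pos
  unfold jac
  rw [Complex.ofReal_ne_zero]
  positivity

lemma integral_comp_two_pi_smul (f : SpaceTime → ℂ) :
    ∫ x, f ((2 * Real.pi) • x) = jac * ∫ x, f x := by
  rw [Measure.integral_comp_smul, jac, Complex.real_smul]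

lemma fourier_dilate (φ : 𝓢(SpaceTime, ℂ)) :
    𝓕 (dilate two_pi_ne_zero φ) = (jac : ℂ) • fourierSchwartz φ := by
  ext ω
  have h1 : fourierSchwartz φ ω = 𝓕 (φ : SpaceTime → ℂ) ((2 * Real.pi)⁻¹ • ω) := rfl
  rw [smul_apply, h1, SchwartzMap.fourier_coe, Real.fourier_eq, Real.fourier_eq,
    smul_eq_mul, ← integral_comp_two_pi_smul]
  refine integral_congr_ae (Eventually.of_forall fun x => ?_)
  simp only [dilate_apply]
  rw [inner_smul_left, inner_smul_right, ← mul_assoc, conj_trivial,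
    mul_inv_cancel₀ two_pi_ne_zero, one_mul]

/-- Links the normalization of the theorem to the transform `𝓕`; the Jacobian later cancels against
the one from rescaling the integral. -/
lemma jac_mul_fourierDist (T : 𝓢'(SpaceTime, ℂ)) (φ : 𝓢(SpaceTime, ℂ)) :
    (jac : ℂ) * fourierDist T φ = 𝓕 T (dilate two_pi_ne_zero φ) := by
  rw [TemperedDistribution.fourier_apply, fourier_dilate, map_smul]
  rfl

lemma memLp_comp_smul {g : SpaceTime → ℂ} (m : Measurable g) (l : MemLp g 2) :
    MemLp (fun v => g ((2 * Real.pi) • v)) 2 := by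
  refine memLp_two_of_lintegral (B := fun v => ‖g ((2 * Real.pi) • v)‖ₑ)
    (m.comp (measurable_const_smul _)).aestronglyMeasurable (ne_of_lt ?_) (fun _ => le_rfl)
  exact (lintegral_comp_smul_le one_le_two_pi (f := fun x => ‖g x‖ₑ ^ 2)
    (by fun_prop)).trans_lt (lintegral_enorm_sq_lt_top l)

/-- A distribution whose Fourier transform is square integrable is a square integrable function. -/
lemma eq_toTemperedDistribution_invFourier {u : 𝓢'(SpaceTime, ℂ)} {g : SpaceTime → ℂ}
    (hg : IsFunction (fourierDist u) g) (m : Measurable g) (l : MemLp g 2) :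
    u = Lp.toTemperedDistribution (invFourier (memLp_comp_smul m l)) := by
  have h : 𝓕 u = Lp.toTemperedDistribution ((memLp_comp_smul m l).toLp _) := by
    ext ψ
    have e1 : dilate two_pi_ne_zero (dilate (inv_ne_zero two_pi_ne_zero) ψ) = ψ := by
      ext x
      rw [dilate_apply, dilate_apply, smul_smul, inv_mul_cancel₀ two_pi_ne_zero, one_smul]
    have e2 := jac_mul_fourierDist u (dilate (inv_ne_zero two_pi_ne_zero) ψ)
    rw [e1, (hg.2 _).2, ← integral_comp_two_pi_smul] at e2
    rw [← e2, Lp.toTemperedDistribution_apply]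
    refine integral_congr_ae ?_
    filter_upwards [(memLp_comp_smul m l).coeFn_toLp] with x hx
    rw [hx, dilate_apply, smul_smul, inv_mul_cancel₀ two_pi_ne_zero, one_smul, smul_eq_mul]
  rw [invFourier_toTemperedDistribution, ← h, fourierInv_fourier_eq]

/-- The integrability clause is there so that the two partial derivatives can be added under one
integral. -/
lemma fourier_lineDeriv_apply {H : SpaceTime → ℂ} (hH : MemLp H 2) (i : Fin 3)
    (ψ : 𝓢(SpaceTime, ℂ)) :
    (𝓕 (∂_{(EuclideanSpace.single i 1 : SpaceTime)}
      (Lp.toTemperedDistribution (invFourier hH))) : 𝓢'(SpaceTime, ℂ)) ψ =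
      2 * Real.pi * Complex.I * ∫ v, (v i : ℂ) * ψ v * H v ∧
    Integrable fun v => (v i : ℂ) * ψ v * H v := by
  have ht : (fun v : SpaceTime => inner ℝ v (EuclideanSpace.single i 1 : SpaceTime)).HasTemperateGrowth := by
    fun_prop
  have e1 : 𝓕 (Lp.toTemperedDistribution (invFourier hH)) =
      Lp.toTemperedDistribution (hH.toLp H) := by
    rw [invFourier_toTemperedDistribution, fourier_fourierInv_eq]
  have ht' : (fun v : SpaceTime =>
      ((inner ℝ v (EuclideanSpace.single i 1 : SpaceTime) : ℝ) : ℂ)).HasTemperateGrowth := by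
    fun_prop
  set χ : 𝓢(SpaceTime, ℂ) := SchwartzMap.smulLeftCLM ℂ (fun v : SpaceTime =>
    ((inner ℝ v (EuclideanSpace.single i 1 : SpaceTime) : ℝ) : ℂ)) ψ with hχ
  have hχv : ∀ v, χ v = (v i : ℂ) * ψ v := by
    intro v
    rw [hχ, SchwartzMap.smulLeftCLM_apply_apply ht']
    simp [EuclideanSpace.inner_single_right]
  refine ⟨?_, ?_⟩
  · rw [TemperedDistribution.fourier_lineDerivOp_eq, e1]
    change (2 * Real.pi * Complex.I) • (Lp.toTemperedDistribution (hH.toLp H)) χ = _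
    rw [Lp.toTemperedDistribution_apply, smul_eq_mul]
    congr 1
    refine integral_congr_ae ?_
    filter_upwards [hH.coeFn_toLp] with v hv
    rw [hv, hχv, smul_eq_mul]
  · simpa only [hχv] using integrable_schwartz_mul hH χ

/-- At `v = (2π)⁻¹ q` the multiplier `2πi (v 0 + v 1)` becomes `i (q 0 + q 1)`. -/
lemma isFunction_fourierDist_dxdy {H : SpaceTime → ℂ} (hH : MemLp H 2)
    (hG : MemLp (fun q : SpaceTime => Complex.I * ((q 0 + q 1 : ℝ) : ℂ) * H ((2 * Real.pi)⁻¹ • q)) 2) :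
    IsFunction (fourierDist (dxdy (Lp.toTemperedDistribution (invFourier hH))))
      (fun q : SpaceTime => Complex.I * ((q 0 + q 1 : ℝ) : ℂ) * H ((2 * Real.pi)⁻¹ • q)) := by
  refine isFunction_of_memLp hG fun φ => mul_left_cancel₀ jac_ne_zero ?_
  rw [jac_mul_fourierDist, ← integral_comp_two_pi_smul, dxdy, FourierTransform.fourier_add]
  obtain ⟨h0, i0⟩ := fourier_lineDeriv_apply hH 0 (dilate two_pi_ne_zero φ)
  obtain ⟨h1, i1⟩ := fourier_lineDeriv_apply hH 1 (dilate two_pi_ne_zero φ)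
  change (𝓕 _ : 𝓢'(SpaceTime, ℂ)) _ + (𝓕 _ : 𝓢'(SpaceTime, ℂ)) _ = _
  rw [h0, h1, ← mul_add, ← integral_add i0 i1, ← integral_const_mul]
  refine integral_congr_ae (Eventually.of_forall fun v => ?_)
  simp only [dilate_apply]
  rw [smul_smul, inv_mul_cancel₀ two_pi_ne_zero, one_smul]
  simp only [PiLp.smul_apply, smul_eq_mul]
  push_cast
  ring

/-! ### Representation of `X_{s,b}` and conclusion. -/

lemma one_le_weight {s b : ℝ} (hs : 0 ≤ s) (hb : 0 ≤ b) (ω : SpaceTime) : 1 ≤ weight s b ω := by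
  rw [weight_eq]
  exact one_le_mul_of_one_le_of_one_le (Real.one_le_rpow (one_le_nb _) hs)
    (Real.one_le_rpow (one_le_jb _) hb)

lemma enorm_weight_mul (s b : ℝ) (g : SpaceTime → ℂ) (ω : SpaceTime) :
    ‖(weight s b ω : ℂ) * g ω‖ₑ = ENNReal.ofReal (weight s b ω) * ‖g ω‖ₑ := by
  rw [enorm_mul, ← ofReal_norm, Complex.norm_of_nonneg (weight_pos s b ω).le]

/-- Elements of `X_{s,b}` are represented on the Fourier side by a measurable function. -/
lemma exists_measurable_of_mem_XSpace {s b : ℝ} (hs : 0 ≤ s) (hb : 0 ≤ b) {u : 𝓢'(SpaceTime, ℂ)}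
    (hu : u ∈ XSpace s b) :
    ∃ g : SpaceTime → ℂ, Measurable g ∧ MemLp g 2 ∧ IsFunction (fourierDist u) g ∧
      ∫⁻ ω, (ENNReal.ofReal (weight s b ω) * ‖g ω‖ₑ) ^ 2 < ∞ ∧
      xNorm s b u = (∫⁻ ω, (ENNReal.ofReal (weight s b ω) * ‖g ω‖ₑ) ^ 2) ^ (1 / 2 : ℝ) := by
  have hu' : xNorm s b u < ∞ := hu
  unfold xNorm at hu'
  obtain ⟨g₀, hg₀⟩ := iInf_lt_iff.1 hu'
  obtain ⟨hf₀, -⟩ := iInf_lt_iff.1 hg₀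
  have hm := hf₀.1.aestronglyMeasurable
  set g := hm.mk g₀
  have hgm : Measurable g := hm.stronglyMeasurable_mk.measurable
  have hf : IsFunction (fourierDist u) g := hf₀.congr hm.ae_eq_mk
  have hn : xNorm s b u = (∫⁻ ω, (ENNReal.ofReal (weight s b ω) * ‖g ω‖ₑ) ^ 2) ^ (1 / 2 : ℝ) := by
    rw [xNorm_eq hf, eLpNorm_two_eq]
    simp only [enorm_weight_mul]
  have hfin : ∫⁻ ω, (ENNReal.ofReal (weight s b ω) * ‖g ω‖ₑ) ^ 2 < ∞ := by
    have h : xNorm s b u < ∞ := hu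
    rw [hn] at h
    exact (ENNReal.rpow_lt_top_iff_of_pos (by norm_num)).1 h
  refine ⟨g, hgm, memLp_two_of_lintegral hgm.aestronglyMeasurable hfin.ne fun ω => ?_, hf, hfin, hn⟩
  refine le_mul_of_one_le_left zero_le ?_
  rw [← ENNReal.ofReal_one]
  exact ENNReal.ofReal_le_ofReal (one_le_weight hs hb ω)

lemma abs_add_le_two_mul_nb (q : SpaceTime) : |q 0 + q 1| ≤ 2 * nb (coords q).1 := by
  have h0 : |q 0| ≤ nb (coords q).1 := (abs_le_jb _).trans (jb_fst_le_nb (coords q).1)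
  have h1 : |q 1| ≤ nb (coords q).1 := (abs_le_jb _).trans (jb_snd_le_nb (coords q).1)
  linarith [abs_add_le (q 0) (q 1)]

/-- For `b ≤ 0` the modulation weight is at most 1 and is discarded; the derivative costs one power
of the spatial bracket. -/
lemma weight_mul_abs_add_le {s b : ℝ} (hb : b ≤ 0) (q : SpaceTime) :
    weight s b q * |q 0 + q 1| ≤ 2 * nb (coords q).1 ^ (1 + s) := by
  have hn := nb_pos (coords q).1
  have h1 : weight s b q ≤ nb (coords q).1 ^ s := by
    rw [weight_eq]
    exact mul_le_of_le_one_right (nb_rpow_nonneg _ _)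
      (Real.rpow_le_one_of_one_le_of_nonpos (one_le_jb _) hb)
  calc _ ≤ nb (coords q).1 ^ s * (2 * nb (coords q).1) :=
        mul_le_mul h1 (abs_add_le_two_mul_nb q) (abs_nonneg _) (nb_rpow_nonneg _ _)
    _ = _ := by rw [Real.rpow_add hn, Real.rpow_one]; ring

lemma exists_isProduct_and_xNorm_le {s b b' : ℝ} (hs : 3 / 4 < s) (hs1 : s < 1) (hb : 1 / 2 < b)
    (hb' : b' ≤ 0) :
    ∃ C : ℝ≥0, ∀ u₁ ∈ XSpace s b, ∀ u₂ ∈ XSpace s b, ∀ u₃ ∈ XSpace s b,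
      (∃ w, IsProduct u₁ u₂ u₃ w) ∧ ∀ w, IsProduct u₁ u₂ u₃ w →
        xNorm s b' (dxdy w) ≤ C * (xNorm s b u₁ * xNorm s b u₂ * xNorm s b u₃) := by
  obtain ⟨C, hC⟩ := exists_lintegral_triConv_le hs hs1 hb
  -- The 4 is the square of the constant in `|ξ + η| ≤ 2⟨ζ⟩`; the root appears because `C` bounds
  -- squared norms.
  refine ⟨NNReal.sqrt (4 * C), fun u₁ hu₁ u₂ hu₂ u₃ hu₃ => ?_⟩
  obtain ⟨g₁, m₁, l₁, F₁, fin₁, N₁⟩ :=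
    exists_measurable_of_mem_XSpace (by linarith) (by linarith) hu₁
  obtain ⟨g₂, m₂, l₂, F₂, fin₂, N₂⟩ :=
    exists_measurable_of_mem_XSpace (by linarith) (by linarith) hu₂
  obtain ⟨g₃, m₃, l₃, F₃, fin₃, N₃⟩ :=
    exists_measurable_of_mem_XSpace (by linarith) (by linarith) hu₃
  have main := hC _ _ _ m₁.enorm m₂.enorm m₃.enorm
  set T := triConv (fun ω => ‖g₁ ω‖ₑ) (fun ω => ‖g₂ ω‖ₑ) (fun ω => ‖g₃ ω‖ₑ)
  have hTm : Measurable T := measurable_triConv m₁.enorm m₂.enorm m₃.enorm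
  set I₁ := ∫⁻ ω, (ENNReal.ofReal (weight s b ω) * ‖g₁ ω‖ₑ) ^ 2
  set I₂ := ∫⁻ ω, (ENNReal.ofReal (weight s b ω) * ‖g₂ ω‖ₑ) ^ 2
  set I₃ := ∫⁻ ω, (ENNReal.ofReal (weight s b ω) * ‖g₃ ω‖ₑ) ^ 2
  have hfin : ∫⁻ ω, (ENNReal.ofReal (nb (coords ω).1 ^ (1 + s)) * T ω) ^ 2 < ∞ :=
    main.trans_lt (ENNReal.mul_lt_top (by simp)
      (ENNReal.mul_lt_top (ENNReal.mul_lt_top fin₁ fin₂) fin₃))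
  have hT2 : ∫⁻ ω, T ω ^ 2 < ∞ := by
    refine lt_of_le_of_lt (lintegral_mono fun ω => ?_) hfin
    gcongr
    refine le_mul_of_one_le_left zero_le ?_
    rw [← ENNReal.ofReal_one]
    exact ENNReal.ofReal_le_ofReal (Real.one_le_rpow (one_le_nb _) (by linarith))
  -- the Fourier transforms in the normalization of Mathlib
  set h₁ : SpaceTime → ℂ := fun v => g₁ ((2 * Real.pi) • v)
  set h₂ : SpaceTime → ℂ := fun v => g₂ ((2 * Real.pi) • v)
  set h₃ : SpaceTime → ℂ := fun v => g₃ ((2 * Real.pi) • v)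
  have k₁ : Measurable h₁ := m₁.comp (measurable_const_smul _)
  have k₂ : Measurable h₂ := m₂.comp (measurable_const_smul _)
  have k₃ : Measurable h₃ := m₃.comp (measurable_const_smul _)
  have hTle : ∀ v, triConv (fun x => ‖h₁ x‖ₑ) (fun x => ‖h₂ x‖ₑ) (fun x => ‖h₃ x‖ₑ) v ≤
      T ((2 * Real.pi) • v) :=
    triConv_comp_smul_le one_le_two_pi m₁.enorm m₂.enorm m₃.enorm
  have hTh : ∫⁻ v, triConv (fun x => ‖h₁ x‖ₑ) (fun x => ‖h₂ x‖ₑ) (fun x => ‖h₃ x‖ₑ) v ^ 2 ≠ ∞ := by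
    refine ne_of_lt (lt_of_le_of_lt ((lintegral_mono fun v => ?_).trans
      (lintegral_comp_smul_le one_le_two_pi (hTm.pow_const 2))) hT2)
    simp only
    gcongr
    exact hTle v
  have hH := memLp_cconv k₁ k₂ k₃ hTh
  have hprod := fourierInv_cconv_ae_eq k₁ k₂ k₃ (memLp_comp_smul m₁ l₁) (memLp_comp_smul m₂ l₂)
    (memLp_comp_smul m₃ l₃) hTh
  have U₁ := isFunction_toTemperedDistribution (invFourier (memLp_comp_smul m₁ l₁))
  have U₂ := isFunction_toTemperedDistribution (invFourier (memLp_comp_smul m₂ l₂))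
  have U₃ := isFunction_toTemperedDistribution (invFourier (memLp_comp_smul m₃ l₃))
  rw [← eq_toTemperedDistribution_invFourier F₁ m₁ l₁] at U₁
  rw [← eq_toTemperedDistribution_invFourier F₂ m₂ l₂] at U₂
  rw [← eq_toTemperedDistribution_invFourier F₃ m₃ l₃] at U₃
  have hw₀ := (isFunction_toTemperedDistribution (invFourier hH)).congr hprod
  refine ⟨⟨_, _, _, _, U₁, U₂, U₃, hw₀⟩, ?_⟩
  rintro w ⟨f₁, f₂, f₃, V₁, V₂, V₃, hw⟩
  have hae : (fun p => f₁ p * f₂ p * f₃ p) =ᵐ[volume] fun x =>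
      invFourier (memLp_comp_smul m₁ l₁) x * invFourier (memLp_comp_smul m₂ l₂) x *
        invFourier (memLp_comp_smul m₃ l₃) x := by
    filter_upwards [V₁.ae_eq U₁, V₂.ae_eq U₂, V₃.ae_eq U₃] with x e₁ e₂ e₃
    rw [e₁, e₂, e₃]
  -- Representatives are unique almost everywhere, so every product `w` is the distribution
  -- constructed above.
  obtain rfl := (hw.congr hae).dist_eq hw₀
  set G : SpaceTime → ℂ := fun q => Complex.I * ((q 0 + q 1 : ℝ) : ℂ) *
    cconv h₁ h₂ h₃ ((2 * Real.pi)⁻¹ • q) with hG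
  have hGm : Measurable G := by
    have e0 : Measurable fun q : SpaceTime => q 0 + q 1 :=
      ((measurable_fst.comp measurable_fst).add (measurable_snd.comp measurable_fst)).comp
        measurable_coords
    exact (measurable_const.mul (Complex.measurable_ofReal.comp e0)).mul
      ((measurable_cconv k₁ k₂ k₃).comp (measurable_const_smul _))
  have hGnorm : ∀ q, ‖G q‖ₑ ≤ ENNReal.ofReal |q 0 + q 1| * T q := by
    intro q
    rw [hG]
    simp only [enorm_mul]
    refine mul_le_mul' (le_of_eq ?_) ((enorm_cconv_le _ _ _ _).trans ((hTle _).trans (le_of_eq ?_)))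
    · rw [← ofReal_norm, ← ofReal_norm, Complex.norm_I, Complex.norm_real,
        Real.norm_eq_abs, ENNReal.ofReal_one, one_mul]
    · rw [smul_smul, mul_inv_cancel₀ two_pi_ne_zero, one_smul]
  have htwo : ∀ q : SpaceTime, 2 * ENNReal.ofReal (nb (coords q).1 ^ (1 + s)) =
      ENNReal.ofReal (2 * nb (coords q).1 ^ (1 + s)) := by
    intro q
    rw [ENNReal.ofReal_mul (by norm_num)]
    simp
  have hWG : ∀ q, ENNReal.ofReal (weight s b' q) * ‖G q‖ₑ ≤
      2 * (ENNReal.ofReal (nb (coords q).1 ^ (1 + s)) * T q) := by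
    intro q
    refine (mul_le_mul_right (hGnorm q) _).trans ?_
    rw [← mul_assoc, ← mul_assoc, ← ENNReal.ofReal_mul (weight_pos s b' q).le, htwo]
    exact mul_le_mul_left (ENNReal.ofReal_le_ofReal (weight_mul_abs_add_le hb' q)) _
  have hsq : ∫⁻ q, (ENNReal.ofReal (weight s b' q) * ‖G q‖ₑ) ^ 2 ≤ 4 * C * (I₁ * I₂ * I₃) := by
    calc _ ≤ ∫⁻ q, 4 * (ENNReal.ofReal (nb (coords q).1 ^ (1 + s)) * T q) ^ 2 := by
          refine lintegral_mono fun q => ?_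
          refine (pow_le_pow_left' (hWG q) 2).trans (le_of_eq ?_)
          rw [mul_pow]
          norm_num
      _ = 4 * ∫⁻ q, (ENNReal.ofReal (nb (coords q).1 ^ (1 + s)) * T q) ^ 2 :=
          lintegral_const_mul' _ _ (by simp)
      _ ≤ 4 * (C * (I₁ * I₂ * I₃)) := by gcongr
      _ = _ := by ring
  have hG2 : MemLp G 2 := by
    refine memLp_two_of_lintegral (B := fun q =>
      2 * (ENNReal.ofReal (nb (coords q).1 ^ (1 + s)) * T q)) hGm.aestronglyMeasurable ?_ fun q => ?_
    · simp only [mul_pow (2 : ℝ≥0∞)]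
      rw [lintegral_const_mul' _ _ (by simp)]
      exact (ENNReal.mul_lt_top (by simp) hfin).ne
    · refine (hGnorm q).trans ?_
      rw [← mul_assoc, htwo]
      refine mul_le_mul_left (ENNReal.ofReal_le_ofReal ((abs_add_le_two_mul_nb q).trans ?_)) _
      have := Real.rpow_le_rpow_of_exponent_le (one_le_nb (coords q).1)
        (show (1 : ℝ) ≤ 1 + s by linarith)
      rw [Real.rpow_one] at this
      linarith
  rw [xNorm_eq (isFunction_fourierDist_dxdy hH hG2), eLpNorm_two_eq, N₁, N₂, N₃]
  have hhalf : (0 : ℝ) ≤ 1 / 2 := by norm_num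
  have hI : ∫⁻ q, ‖(weight s b' q : ℂ) * G q‖ₑ ^ 2 ≤ 4 * C * (I₁ * I₂ * I₃) := by
    simp only [enorm_weight_mul]
    exact hsq
  refine (ENNReal.rpow_le_rpow hI hhalf).trans (le_of_eq ?_)
  rw [ENNReal.mul_rpow_of_nonneg _ _ hhalf, ENNReal.mul_rpow_of_nonneg _ _ hhalf,
    ENNReal.mul_rpow_of_nonneg _ _ hhalf]
  congr 1
  · rw [NNReal.sqrt_eq_rpow, ENNReal.coe_rpow_of_nonneg _ hhalf, ENNReal.coe_mul,
      ENNReal.mul_rpow_of_nonneg _ _ hhalf]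
    rfl
  · rw [ENNReal.mul_rpow_of_nonneg _ _ hhalf]

end MZK

end

theorem lemma3p3 (s : ℝ) (hs₁ : 3 / 4 < s) (hs₂ : s < 1) (ε : ℝ) (hε₁ : 0 < ε) (hε₂ : ε ≤ 1 / 4) :
    ∃ C : ℝ≥0, ∀ u₁ ∈ MZK.XSpace s (1 / 2 + ε), ∀ u₂ ∈ MZK.XSpace s (1 / 2 + ε),
      ∀ u₃ ∈ MZK.XSpace s (1 / 2 + ε),
      (∃ w, MZK.IsProduct u₁ u₂ u₃ w) ∧
      ∀ w, MZK.IsProduct u₁ u₂ u₃ w →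
        MZK.xNorm s (-(1 / 2) + 2 * ε) (MZK.dxdy w) ≤
          C * (MZK.xNorm s (1 / 2 + ε) u₁ * MZK.xNorm s (1 / 2 + ε) u₂ *
            MZK.xNorm s (1 / 2 + ε) u₃) :=
  -- The last condition, `-1/2 + 2ε ≤ 0`, is where `ε ≤ 1/4` enters.
  MZK.exists_isProduct_and_xNorm_le hs₁ hs₂ (by linarith) (by linarith)
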